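/- \textbf{Setting.} Let $r$ and $K_0\ge 2$ be fixed integers and let $N,T\to\infty$ jointly (along sequences $N=N_n$, $T=T_n$). For each $n$ the data satisfy the factor model $X=FB^\top+E$, where $X$ is $T\times N$, $F=(f_{tl})$ is a random $T\times r$ matrix, and the deterministic $N\times r$ loading matrix $B$ with rows $b_1,\dots,b_N$ has a group structure: there is a partition $\mathcal G(K_0)=\{\mathcal G_1,\dots,\mathcal G_{K_0}\}$ of $\{1,\dots,N\}$ into nonempty groups such that $b_i$ has a common value $b_{\mathcal G,k}$ for all $i\in\mathcal G_k$. Suppose there are positive constants $M,c_1,c_2$, not depending on $n$, such that: (1) $E f_{tl}=0$, $E f_{tl}^2=1$, $E f_{tl}^4\le M$ for all $t,l$; $F^\top F/T=I_r$ almost surely; and $E\|v^\top F\|^2\le M$ for every deterministic unit vector $v\in\mathbb R^T$. (2) $|b_{jl}|\le M$ for all $j,l$, and $N^{-1}B^\top B\to\Sigma_B$, where the eigenvalues of $\Sigma_B$ are distinct and lie in $[c_2,c_1]$. (3) $E=P_1SP_2$, where $P_1,P_2$ are deterministic square matrices such that all eigenvalues of $P_1^\top P_1$ and $P_2^\top P_2$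 lie in $[c_2,c_1]$; the entries $\epsilon_{tj}$ of the $T\times N$ matrix $S$ are independent with $E\epsilon_{tj}=0$, $E\epsilon_{tj}^2=1$, $E\epsilon_{tj}^4\le M$; and $S$ is independent of $F$. \textbf{Estimators.} Let $\Pi_N=I_N-N^{-1}\mathbf 1\mathbf 1^\top$ and, for a deterministic tuning parameter $\lambda=\lambda_n$, let $D=I_N+\lambda\Pi_N$. Let the columns of $\hat F$ be $\sqrt T$ times orthonormal eigenvectors of $XD^{-1}X^\top$ belonging, in this order, to its $r$ largest eigenvalues, and let $\hat B=T^{-1}D^{-1}X^\top\hat F$ (the penalized PCA, or PPCA, loadings), with rows $\hat b_1,\dots,\hat b_N$. Let $\Lambda_r$ be the diagonal matrix of the $r$ largest eigenvalues of $XD^{-1}X^\top/(NT)$, put $H=(N^{-1}B^\top D^{-1}B)(F^\top\hat F/T)\Lambda_r^{-1}$, and $$d_n=\min_{k_1\ne k_2}\ \min_{i\in\mathcal G_{k_1},\,j\in\mathcal G_{k_2}}\|H^\top(b_i-b_j)\|_2 .$$ Let $B^*=\mathrm{diag}(1,\dots,1,0)\,U^\top B$, where $U$ is an orthogonal matrix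 of eigenvectors of $D^{-1}$ with last column $N^{-1/2}\mathbf 1$; thus $\|B^*\|_F=\|\Pi_NB\|_F$. \textbf{Clustering.} Let $\hat\Delta_{ij}=r^{-1}\|\hat b_i-\hat b_j\|_1$. Complete-linkage agglomerative hierarchical clustering starts with the $N$ singletons and repeatedly merges two distinct clusters $\mathcal A,\mathcal A'$ at the smallest distance $\max_{i\in\mathcal A,\,j\in\mathcal A'}\hat\Delta_{ij}$, until $K_0$ clusters are left; the resulting partition is $\hat{\mathcal G}(K_0)$. \textbf{Theorem.} Suppose that (1)--(3) hold, that $\lambda\asymp N/(T\|B^*\|_F^2)$, and that $\max\{\sqrt{N/T},\,N^{-1/2}\}=o(d_n)$ in probability, that is, $P\big(\max\{\sqrt{N/T},N^{-1/2}\}\le\varepsilon d_n\big)\to1$ for every $\varepsilon>0$. Then $$P\big(\hat{\mathcal G}(K_0)=\mathcal G(K_0)\big)\to 1 ,$$ where the event is that the algorithm returns the true partition however ties are broken. -/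

import Mathlib

open MeasureTheory ProbabilityTheory Filter Topology Matrix

noncomputable section

namespace PPCA

/-! ### Matrices -/

/-- The Frobenius norm `‖A‖_F = Tr(AᵀA)^{1/2}`. -/
def frobNorm {m k : ℕ} (A : Matrix (Fin m) (Fin k) ℝ) : ℝ :=
  Real.sqrt (Aᵀ * A).trace

/-- The Euclidean norm of a vector. -/
def l2Norm {k : ℕ} (v : Fin k → ℝ) : ℝ := ‖WithLp.toLp 2 v‖

/-- The `ℓ₁` norm of a vector. -/
def l1Norm {k : ℕ} (v : Fin k → ℝ) : ℝ := ∑ l, |v l|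

/-- The `(j+1)`-st largest eigenvalue, with multiplicity, of a real symmetric `m × m` matrix
(`j = 0, …, m - 1`); the value is `0` outside this range. -/
def eigDesc {m : ℕ} (A : Matrix (Fin m) (Fin m) ℝ) (j : ℕ) : ℝ :=
  if h : A.IsHermitian ∧ j < m then
    h.1.eigenvalues₀ ⟨j, by simpa using h.2⟩
  else 0

/-- The normalized Laplacian `Π_N = I_N - A / N`, where `A` is the all-one matrix. -/
def laplacian (N : ℕ) : Matrix (Fin N) (Fin N) ℝ :=
  1 - (1 / (N : ℝ)) • Matrix.of (fun _ _ => (1 : ℝ))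

/-- `D = I_N + λ Π_N`. -/
def penaltyMatrix (N : ℕ) (lam : ℝ) : Matrix (Fin N) (Fin N) ℝ :=
  1 + lam • laplacian N

/-- `‖B*‖_F²`, where `B* = diag(1,…,1,0) Uᵀ B` and `U` is an orthogonal matrix of eigenvectors of
`D⁻¹` whose last column is the eigenvector `N^{-1/2} (1,…,1)` of the eigenvalue `1`. This number
does not depend on the choice of `U`: it is `‖Π_N B‖_F²`, by `frobNorm_diag_mul_sq`. -/
def bStarSq {N r : ℕ} (B : Matrix (Fin N) (Fin r) ℝ) : ℝ :=
  frobNorm (laplacian N * B) ^ 2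

lemma frobNorm_sq {m k : ℕ} (A : Matrix (Fin m) (Fin k) ℝ) :
    frobNorm A ^ 2 = (Aᵀ * A).trace := by
  refine Real.sq_sqrt ?_
  simp only [Matrix.trace, Matrix.diag, Matrix.mul_apply, Matrix.transpose_apply]
  exact Finset.sum_nonneg fun i _ => Finset.sum_nonneg fun j _ => mul_self_nonneg _

theorem frobNorm_diag_mul_sq {m r : ℕ} (U : Matrix (Fin (m + 1)) (Fin (m + 1)) ℝ)
    (hU : Uᵀ * U = 1) (hlast : ∀ i, U i (Fin.last m) = 1 / Real.sqrt ((m + 1 : ℕ) : ℝ))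
    (B : Matrix (Fin (m + 1)) (Fin r) ℝ) :
    frobNorm (Matrix.diagonal (fun i => if i = Fin.last m then (0 : ℝ) else 1) * Uᵀ * B) ^ 2
      = bStarSq B := by
  have hU' : U * Uᵀ = 1 := mul_eq_one_comm.mp hU
  set J : Matrix (Fin (m + 1)) (Fin (m + 1)) ℝ :=
    Matrix.diagonal (fun i => if i = Fin.last m then (0 : ℝ) else 1) with hJ
  have hJJ : J * J = J := by
    rw [hJ, Matrix.diagonal_mul_diagonal]
    congr 1
    funext i
    split_ifs <;> simp
  have hJt : Jᵀ = J := Matrix.diagonal_transpose _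
  have hL : U * J * Uᵀ = laplacian (m + 1) := by
    have hJ1 : J = 1 - Matrix.diagonal (fun i => if i = Fin.last m then (1 : ℝ) else 0) := by
      rw [hJ, ← Matrix.diagonal_one, Matrix.diagonal_sub]
      congr 1
      funext i
      split_ifs <;> simp
    have hE : U * Matrix.diagonal (fun i => if i = Fin.last m then (1 : ℝ) else 0) * Uᵀ
        = (1 / ((m + 1 : ℕ) : ℝ)) • Matrix.of (fun _ _ => (1 : ℝ)) := by
      ext i j
      have hpos : (0 : ℝ) ≤ ((m + 1 : ℕ) : ℝ) := by positivity
      rw [Matrix.mul_apply]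
      simp only [Matrix.mul_diagonal, Matrix.transpose_apply]
      rw [Finset.sum_eq_single (Fin.last m)]
      · rw [hlast, hlast]
        simp only [if_true, mul_one, Matrix.smul_apply, Matrix.of_apply, smul_eq_mul]
        rw [div_mul_div_comm, Real.mul_self_sqrt hpos, one_mul]
      · intro b _ hb
        simp [hb]
      · simp
    rw [hJ1, Matrix.mul_sub, Matrix.sub_mul, Matrix.mul_one, hU', hE, laplacian]
  have hLt : (laplacian (m + 1))ᵀ = laplacian (m + 1) := by
    rw [← hL, Matrix.transpose_mul, Matrix.transpose_mul, Matrix.transpose_transpose, hJt,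
      Matrix.mul_assoc]
  have hLL : laplacian (m + 1) * laplacian (m + 1) = laplacian (m + 1) := by
    rw [← hL]
    calc U * J * Uᵀ * (U * J * Uᵀ) = U * J * (Uᵀ * U) * J * Uᵀ := by
          simp only [Matrix.mul_assoc]
      _ = U * (J * J) * Uᵀ := by rw [hU, Matrix.mul_one]; simp only [Matrix.mul_assoc]
      _ = U * J * Uᵀ := by rw [hJJ]
  rw [bStarSq, frobNorm_sq, frobNorm_sq]
  congr 1
  calc (J * Uᵀ * B)ᵀ * (J * Uᵀ * B) = Bᵀ * (U * (J * J) * Uᵀ) * B := by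
        simp only [Matrix.transpose_mul, Matrix.transpose_transpose, hJt, Matrix.mul_assoc]
    _ = Bᵀ * (laplacian (m + 1) * laplacian (m + 1)) * B := by rw [hJJ, hL, hLL]
    _ = (laplacian (m + 1) * B)ᵀ * (laplacian (m + 1) * B) := by
        rw [Matrix.transpose_mul, hLt]; simp only [Matrix.mul_assoc]

/-! ### The penalized PCA estimators -/

/-- `X D⁻¹ Xᵀ`. -/
def gram {T N : ℕ} (lam : ℝ) (X : Matrix (Fin T) (Fin N) ℝ) : Matrix (Fin T) (Fin T) ℝ :=
  X * (penaltyMatrix N lam)⁻¹ * Xᵀ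

/-- `Fhat` is a PPCA factor score matrix: its columns are `√T` times orthonormal eigenvectors of
`X D⁻¹ Xᵀ` belonging, in this order, to its `r` largest eigenvalues. -/
def IsFactorEstimator {T N r : ℕ} (lam : ℝ) (X : Matrix (Fin T) (Fin N) ℝ)
    (Fhat : Matrix (Fin T) (Fin r) ℝ) : Prop :=
  Fhatᵀ * Fhat = (T : ℝ) • (1 : Matrix (Fin r) (Fin r) ℝ) ∧
  gram lam X * Fhat = Fhat * Matrix.diagonal (fun l : Fin r => eigDesc (gram lam X) l)

/-- The PPCA loading matrix `Bhat = T⁻¹ D⁻¹ Xᵀ Fhat`. -/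
def loadingEstimator {T N r : ℕ} (lam : ℝ) (X : Matrix (Fin T) (Fin N) ℝ)
    (Fhat : Matrix (Fin T) (Fin r) ℝ) : Matrix (Fin N) (Fin r) ℝ :=
  (1 / (T : ℝ)) • ((penaltyMatrix N lam)⁻¹ * Xᵀ * Fhat)

/-- The rotation `H = (N⁻¹ Bᵀ D⁻¹ B) (Fᵀ Fhat / T) Λ_r⁻¹`, where `Λ_r` is the diagonal matrix of
the `r` largest eigenvalues of `X D⁻¹ Xᵀ / (NT)`. -/
def rotation {T N r : ℕ} (lam : ℝ) (B : Matrix (Fin N) (Fin r) ℝ)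
    (F : Matrix (Fin T) (Fin r) ℝ) (X : Matrix (Fin T) (Fin N) ℝ)
    (Fhat : Matrix (Fin T) (Fin r) ℝ) : Matrix (Fin r) (Fin r) ℝ :=
  ((1 / (N : ℝ)) • (Bᵀ * (penaltyMatrix N lam)⁻¹ * B)) *
    ((1 / (T : ℝ)) • (Fᵀ * Fhat)) *
    (Matrix.diagonal
      (fun l : Fin r => eigDesc ((1 / ((N : ℝ) * (T : ℝ))) • gram lam X) l))⁻¹

/-- The minimal rotated distance `min ‖Hᵀ (b_i - b_j)‖` over `i`, `j` in different groups, the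
group of `i` being labelled `g i`. -/
def minSignal {N r K : ℕ} (g : Fin N → Fin K) (B : Matrix (Fin N) (Fin r) ℝ)
    (H : Matrix (Fin r) (Fin r) ℝ) : ℝ :=
  sInf {x | ∃ i j : Fin N, g i ≠ g j ∧ x = l2Norm (Hᵀ *ᵥ (B i - B j))}

/-! ### Agglomerative hierarchical clustering -/

/-- The estimated distance matrix, with entries `‖b_i - b_j‖₁ / r`. -/
def distMatrix {N r : ℕ} (B : Matrix (Fin N) (Fin r) ℝ) (i j : Fin N) : ℝ :=
  (1 / (r : ℝ)) * l1Norm (B i - B j)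

/-- Complete linkage: the largest distance between a member of `A` and a member of `A'`. -/
def linkage {N : ℕ} (d : Fin N → Fin N → ℝ) (A A' : Finset (Fin N)) : ℝ :=
  if h : (A ×ˢ A').Nonempty then (A ×ˢ A').sup' h (fun p => d p.1 p.2) else 0

/-- One step of the algorithm: two distinct clusters at the smallest distance are merged. -/
inductive AHCStep {N : ℕ} (d : Fin N → Fin N → ℝ) :
    Finset (Finset (Fin N)) → Finset (Finset (Fin N)) → Prop
  | merge (P : Finset (Finset (Fin N))) (A A' : Finset (Fin N))
      (hA : A ∈ P) (hA' : A' ∈ P) (hne : A ≠ A')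
      (hmin : ∀ C ∈ P, ∀ C' ∈ P, C ≠ C' → linkage d A A' ≤ linkage d C C') :
      AHCStep d P (insert (A ∪ A') ((P.erase A).erase A'))

/-- `P` is a possible output of the algorithm for the group number `K`: it has `K` clusters and is
reached from the partition into singletons by merging steps. Several outputs are possible only if
there are ties among the smallest distances. -/
def IsAHCOutput {N : ℕ} (d : Fin N → Fin N → ℝ) (K : ℕ) (P : Finset (Finset (Fin N))) : Prop :=
  Relation.ReflTransGen (AHCStep d) (Finset.univ.image fun i => {i}) P ∧ P.card = K

/-- The true partition, the set of the groups `{i | g i = k}`. -/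
def truePartition {N K : ℕ} (g : Fin N → Fin K) : Finset (Finset (Fin N)) :=
  Finset.univ.image fun k => Finset.univ.filter fun i => g i = k

/-! ### Assumptions on the factor model -/

/-- The factor scores are centred with unit variance and bounded fourth moments, `FᵀF / T = I_r`
almost surely, and `E‖vᵀF‖² ≤ M` for all deterministic unit vectors `v`. -/
def FactorAssumption {Ω : Type*} [MeasurableSpace Ω] (μ : Measure Ω) {r : ℕ} (T : ℕ → ℕ)
    (F : (n : ℕ) → Ω → Matrix (Fin (T n)) (Fin r) ℝ) : Prop :=
  (∀ n t l, Measurable fun ω => F n ω t l) ∧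
  ∃ M : ℝ, 0 < M ∧ ∀ n,
    (∀ t l, MemLp (fun ω => F n ω t l) 4 μ ∧
      ∫ ω, F n ω t l ∂μ = 0 ∧ ∫ ω, F n ω t l ^ 2 ∂μ = 1 ∧ ∫ ω, F n ω t l ^ 4 ∂μ ≤ M) ∧
    (∀ᵐ ω ∂μ, (1 / (T n : ℝ)) • ((F n ω)ᵀ * F n ω) = 1) ∧
    (∀ v : Fin (T n) → ℝ, l2Norm v = 1 → ∫ ω, l2Norm (v ᵥ* F n ω) ^ 2 ∂μ ≤ M)

/-- The loadings are uniformly bounded and `BᵀB / N` converges to a symmetric matrix with distinct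
positive eigenvalues. -/
def LoadingAssumption {r : ℕ} (N : ℕ → ℕ)
    (B : (n : ℕ) → Matrix (Fin (N n)) (Fin r) ℝ) : Prop :=
  (∃ M : ℝ, ∀ n j l, |B n j l| ≤ M) ∧
  ∃ SigmaB : Matrix (Fin r) (Fin r) ℝ,
    Tendsto (fun n => (1 / (N n : ℝ)) • ((B n)ᵀ * B n)) atTop (𝓝 SigmaB) ∧
    ∃ hS : SigmaB.IsHermitian, Function.Injective hS.eigenvalues ∧
      ∃ c₁ c₂ : ℝ, 0 < c₂ ∧ ∀ l, c₂ ≤ hS.eigenvalues l ∧ hS.eigenvalues l ≤ c₁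

/-- The errors are `P₁ S P₂` with deterministic square matrices `P₁`, `P₂` such that the
eigenvalues of `P₁ᵀP₁` and `P₂ᵀP₂` lie between two positive constants; the entries of `S` are
independent, centred, with unit variance and bounded fourth moments, and `S` is independent
of `F`. -/
def ErrorAssumption {Ω : Type*} [MeasurableSpace Ω] (μ : Measure Ω) {r : ℕ} (N T : ℕ → ℕ)
    (F : (n : ℕ) → Ω → Matrix (Fin (T n)) (Fin r) ℝ)
    (S : (n : ℕ) → Ω → Matrix (Fin (T n)) (Fin (N n)) ℝ)
    (P₁ : (n : ℕ) → Matrix (Fin (T n)) (Fin (T n)) ℝ)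
    (P₂ : (n : ℕ) → Matrix (Fin (N n)) (Fin (N n)) ℝ) : Prop :=
  (∀ n t j, Measurable fun ω => S n ω t j) ∧
  (∀ n, iIndepFun (fun (p : Fin (T n) × Fin (N n)) ω => S n ω p.1 p.2) μ) ∧
  (∀ n, IndepFun (fun ω (p : Fin (T n) × Fin (N n)) => S n ω p.1 p.2)
    (fun ω (p : Fin (T n) × Fin r) => F n ω p.1 p.2) μ) ∧
  (∃ M : ℝ, ∀ n t j, MemLp (fun ω => S n ω t j) 4 μ ∧
    ∫ ω, S n ω t j ∂μ = 0 ∧ ∫ ω, S n ω t j ^ 2 ∂μ = 1 ∧ ∫ ω, S n ω t j ^ 4 ∂μ ≤ M) ∧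
  ∃ c₁ c₂ : ℝ, 0 < c₂ ∧ ∀ n,
    (∀ t < T n, c₂ ≤ eigDesc ((P₁ n)ᵀ * P₁ n) t ∧ eigDesc ((P₁ n)ᵀ * P₁ n) t ≤ c₁) ∧
    (∀ j < N n, c₂ ≤ eigDesc ((P₂ n)ᵀ * P₂ n) j ∧ eigDesc ((P₂ n)ᵀ * P₂ n) j ≤ c₁)

end PPCA

end

/-! Complete linkage returns the true groups as soon as one threshold separates all within-group
distances from all between-group ones (`isAHCOutput_iff_of_separated`): with more clusters than
groups, two clusters share a group by pigeonhole, so a closest pair never mixes groups. It remains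
to find such a threshold with probability tending to one.

Put `V = Eᵀ F̂` and `m = max(√(N/T), N^{-1/2})`. On differences of rows, `D⁻¹` acts as the scalar
`1/(1+λ)`, so up to one common factor the difference of two estimated loadings is `F̂ᵀF (b_i - b_j)
+ V_i - V_j` (`loadingEstimator_row_sub`). The first term vanishes inside a group. The threshold
exists if `‖V‖ ≲ T m`, if `F̂ᵀF` is bounded below by a multiple of `T`, and if `‖b_i - b_j‖` is much
larger than `m` between groups.

The noise bound comes from the eigenvalue equation multiplied by `Eᵀ`. The `r` leading eigenvalues
are at least of order `NT`, by Courant-Fischer on the column space of `F`; since `λ‖B*‖²` is of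
order `N/T`, the penalty costs a negligible part of the signal. Second moments give `‖EᵀF‖ ≲ √(NT)`,
and `‖EᵀE‖` and `‖EᵀE D⁻¹B‖` of order `√N T` in Frobenius norm when `N ≤ T`. Division by `NT` leaves
`√(NT) + T/√N ≲ T m`, plus a multiple of `‖V‖/√N` that is absorbed (`norm_error_estimator_le`).
Multiplying the same equation by `F̂ᵀ` shows that `F̂ᵀF` is well conditioned
(`l2Norm_cross_mulVec_ge`).

Finally `‖H‖` is bounded, so `d_n ≤ ‖H‖ ‖b_i - b_j‖` turns the assumption on `d_n` into the required
signal strength. As the loadings are bounded, so is `d_n`, and `√(N/T) = o(d_n)` then forces `N ≤ T`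
eventually. -/

namespace PPCA

/-! ### Complete linkage recovers separated groups -/

/-- `P` is a partition of the index set that refines the partition given by the labels `g`. -/
structure Refines {N K : ℕ} (g : Fin N → Fin K) (P : Finset (Finset (Fin N))) : Prop where
  nonempty : ∀ A ∈ P, A.Nonempty
  label : ∀ A ∈ P, ∀ i ∈ A, ∀ j ∈ A, g i = g j
  cover : ∀ i, ∃ A ∈ P, i ∈ A
  unique : ∀ A ∈ P, ∀ A' ∈ P, ∀ i, i ∈ A → i ∈ A' → A = A'

lemma refines_singletons {N K : ℕ} (g : Fin N → Fin K) :
    Refines g (Finset.univ.image fun i => {i}) where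
  nonempty := by simp
  label := by simp
  cover i := ⟨{i}, by simp, by simp⟩
  unique := by
    simp only [Finset.mem_image, Finset.mem_univ, true_and]
    rintro _ ⟨a, rfl⟩ _ ⟨b, rfl⟩ i hi hi'
    simp only [Finset.mem_singleton] at hi hi'
    rw [← hi, ← hi']

lemma Refines.union_notMem {N K : ℕ} {g : Fin N → Fin K} {P : Finset (Finset (Fin N))}
    (h : Refines g P) {A A' : Finset (Fin N)} (hA : A ∈ P) (hA' : A' ∈ P) (hne : A ≠ A') :
    A ∪ A' ∉ P := by
  intro hU
  obtain ⟨i, hi⟩ := h.nonempty A hA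
  obtain ⟨j, hj⟩ := h.nonempty A' hA'
  exact hne ((h.unique A hA _ hU i hi (by simp [hi])).trans
    (h.unique A' hA' _ hU j hj (by simp [hj])).symm)

lemma card_merge_le {α : Type*} [DecidableEq α] (P : Finset α) {A A' U : α}
    (hA : A ∈ P) (hA' : A' ∈ P) (hne : A ≠ A') :
    (insert U ((P.erase A).erase A')).card + 1 ≤ P.card := by
  have h1 := Finset.card_insert_le U ((P.erase A).erase A')
  have h2 := Finset.card_erase_add_one (Finset.mem_erase.mpr ⟨hne.symm, hA'⟩)
  have h3 := Finset.card_erase_add_one hA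
  omega

/-- Equality needs the union to be a new cluster, which holds because clusters are nonempty and
disjoint. Without the refinement property only `card_merge_le` is available. -/
lemma Refines.card_merge {N K : ℕ} {g : Fin N → Fin K} {P : Finset (Finset (Fin N))}
    (h : Refines g P) {A A' : Finset (Fin N)} (hA : A ∈ P) (hA' : A' ∈ P) (hne : A ≠ A') :
    (insert (A ∪ A') ((P.erase A).erase A')).card + 1 = P.card := by
  have h1 := Finset.card_insert_of_notMem (s := (P.erase A).erase A') (a := A ∪ A')
    (fun hm => h.union_notMem hA hA' hne
      (Finset.mem_of_mem_erase (Finset.mem_of_mem_erase hm)))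
  have h2 := Finset.card_erase_add_one (Finset.mem_erase.mpr ⟨hne.symm, hA'⟩)
  have h3 := Finset.card_erase_add_one hA
  omega

lemma Refines.merge {N K : ℕ} {g : Fin N → Fin K} {P : Finset (Finset (Fin N))}
    (h : Refines g P) {A A' : Finset (Fin N)} (hA : A ∈ P) (hA' : A' ∈ P)
    (hlab : ∀ i ∈ A, ∀ j ∈ A', g i = g j) :
    Refines g (insert (A ∪ A') ((P.erase A).erase A')) where
  nonempty C hC := by
    rcases Finset.mem_insert.mp hC with rfl | hC
    · exact (h.nonempty A hA).mono Finset.subset_union_left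
    · exact h.nonempty C (Finset.mem_of_mem_erase (Finset.mem_of_mem_erase hC))
  label C hC i hi j hj := by
    rcases Finset.mem_insert.mp hC with rfl | hC
    · rcases Finset.mem_union.mp hi with hi | hi <;> rcases Finset.mem_union.mp hj with hj | hj
      · exact h.label A hA i hi j hj
      · exact hlab i hi j hj
      · exact (hlab j hj i hi).symm
      · exact h.label A' hA' i hi j hj
    · exact h.label C (Finset.mem_of_mem_erase (Finset.mem_of_mem_erase hC)) i hi j hj
  cover i := by
    obtain ⟨C, hC, hi⟩ := h.cover i
    by_cases h1 : C = A
    · exact ⟨A ∪ A', by simp, by simp [← h1, hi]⟩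
    by_cases h2 : C = A'
    · exact ⟨A ∪ A', by simp, by simp [← h2, hi]⟩
    exact ⟨C, by simp [h1, h2, hC], hi⟩
  unique := by
    have key : ∀ C ∈ (P.erase A).erase A', ∀ i, i ∈ A ∪ A' → i ∉ C := by
      intro C hC i hi hiC
      simp only [Finset.mem_erase] at hC
      rcases Finset.mem_union.mp hi with hi | hi
      · exact hC.2.1 (h.unique C hC.2.2 A hA i hiC hi)
      · exact hC.1 (h.unique C hC.2.2 A' hA' i hiC hi)
    intro C hC C' hC' i hi hi'
    rcases Finset.mem_insert.mp hC with rfl | hC <;>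
      rcases Finset.mem_insert.mp hC' with rfl | hC'
    · rfl
    · exact absurd hi' (key C' hC' i hi)
    · exact absurd hi (key C hC i hi')
    · exact h.unique C (Finset.mem_of_mem_erase (Finset.mem_of_mem_erase hC)) C'
        (Finset.mem_of_mem_erase (Finset.mem_of_mem_erase hC')) i hi hi'

lemma Refines.exists_label {N K : ℕ} [Nonempty (Fin K)] {g : Fin N → Fin K}
    {P : Finset (Finset (Fin N))} (h : Refines g P) :
    ∃ f : Finset (Fin N) → Fin K, ∀ A ∈ P, ∀ i ∈ A, g i = f A := by
  have : ∀ A : Finset (Fin N), ∃ k : Fin K, A ∈ P → ∀ i ∈ A, g i = k := by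
    intro A
    by_cases hA : A ∈ P
    · obtain ⟨i, hi⟩ := h.nonempty A hA
      exact ⟨g i, fun _ j hj => h.label A hA j hj i hi⟩
    · exact ⟨Classical.arbitrary _, fun h' => absurd h' hA⟩
  choose f hf using this
  exact ⟨f, hf⟩

/-- The label map from clusters to groups is onto, hence bijective when there are `K` clusters, and
each cluster is then a full fibre of `g`. -/
lemma Refines.eq_truePartition {N K : ℕ} [Nonempty (Fin K)] {g : Fin N → Fin K} (hg : Function.Surjective g)
    {P : Finset (Finset (Fin N))} (h : Refines g P) (hcard : P.card = K) :
    P = truePartition g := by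
  obtain ⟨f, hf⟩ := h.exists_label
  have himg : P.image f = Finset.univ := by
    ext k
    simp only [Finset.mem_image, Finset.mem_univ, iff_true]
    obtain ⟨i, rfl⟩ := hg k
    obtain ⟨A, hA, hi⟩ := h.cover i
    exact ⟨A, hA, (hf A hA i hi).symm⟩
  have hinj : Set.InjOn f P := by
    apply Finset.card_image_iff.mp
    rw [himg, hcard, Finset.card_univ, Fintype.card_fin]
  have hfib : ∀ A ∈ P, A = Finset.univ.filter fun i => g i = f A := by
    intro A hA
    ext i
    simp only [Finset.mem_filter, Finset.mem_univ, true_and]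
    refine ⟨hf A hA i, fun hi => ?_⟩
    obtain ⟨C, hC, hiC⟩ := h.cover i
    rwa [hinj hA hC (hi.symm.trans (hf C hC i hiC))]
  ext A
  simp only [truePartition, Finset.mem_image, Finset.mem_univ, true_and]
  constructor
  · intro hA
    exact ⟨f A, (hfib A hA).symm⟩
  · rintro ⟨k, rfl⟩
    obtain ⟨C, hC, rfl⟩ := Finset.mem_image.mp (himg ▸ Finset.mem_univ k)
    rwa [← hfib C hC]

lemma le_linkage {N : ℕ} (d : Fin N → Fin N → ℝ) {A A' : Finset (Fin N)} {i j : Fin N}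
    (hi : i ∈ A) (hj : j ∈ A') : d i j ≤ linkage d A A' := by
  have hm : (i, j) ∈ A ×ˢ A' := Finset.mk_mem_product hi hj
  rw [linkage, dif_pos ⟨_, hm⟩]
  exact Finset.le_sup' (fun p : Fin N × Fin N => d p.1 p.2) hm

lemma linkage_le {N : ℕ} (d : Fin N → Fin N → ℝ) {A A' : Finset (Fin N)} {δ : ℝ}
    (hA : A.Nonempty) (hA' : A'.Nonempty) (h : ∀ i ∈ A, ∀ j ∈ A', d i j ≤ δ) :
    linkage d A A' ≤ δ := by
  rw [linkage, dif_pos (hA.product hA')]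
  refine Finset.sup'_le _ _ fun p hp => ?_
  rw [Finset.mem_product] at hp
  exact h _ hp.1 _ hp.2

/-- If there are more clusters than groups, two of them lie in the same group. -/
lemma Refines.exists_pair {N K : ℕ} [Nonempty (Fin K)] {g : Fin N → Fin K} {P : Finset (Finset (Fin N))}
    (h : Refines g P) (hcard : K < P.card) :
    ∃ A ∈ P, ∃ A' ∈ P, A ≠ A' ∧ ∀ i ∈ A, ∀ j ∈ A', g i = g j := by
  obtain ⟨f, hf⟩ := h.exists_label
  obtain ⟨A, hA, A', hA', hne, he⟩ := Finset.exists_ne_map_eq_of_card_lt_of_maps_to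
    (s := P) (t := (Finset.univ : Finset (Fin K))) (by simpa using hcard) (f := f)
    (fun _ _ => Finset.mem_coe.mpr (Finset.mem_univ _))
  exact ⟨A, hA, A', hA', hne, fun i hi j hj => by rw [hf A hA i hi, hf A' hA' j hj, he]⟩

/-- A pair of clusters from the same group has linkage at most `δ`, because complete linkage is a
maximum of within-group distances; a single pair of indices with different labels would push the
minimal linkage above `δ`. -/
lemma Refines.label_of_minimal {N K : ℕ} [Nonempty (Fin K)] {g : Fin N → Fin K} {d : Fin N → Fin N → ℝ} {δ : ℝ}
    (hsame : ∀ i j, g i = g j → d i j ≤ δ) (hdiff : ∀ i j, g i ≠ g j → δ < d i j)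
    {P : Finset (Finset (Fin N))} (h : Refines g P) (hcard : K < P.card)
    {A A' : Finset (Fin N)}
    (hmin : ∀ C ∈ P, ∀ C' ∈ P, C ≠ C' → linkage d A A' ≤ linkage d C C') :
    ∀ i ∈ A, ∀ j ∈ A', g i = g j := by
  obtain ⟨C, hC, C', hC', hne, hlab⟩ := h.exists_pair hcard
  intro i hi j hj
  by_contra hij
  have h1 := hmin C hC C' hC' hne
  have h2 := linkage_le d (h.nonempty C hC) (h.nonempty C' hC')
    (fun a ha b hb => hsame a b (hlab a ha b hb))
  have h3 := le_linkage d hi hj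
  have h4 := hdiff i j hij
  linarith

lemma Refines.exists_step {N K : ℕ} [Nonempty (Fin K)] {g : Fin N → Fin K} {d : Fin N → Fin N → ℝ} {δ : ℝ}
    (hsame : ∀ i j, g i = g j → d i j ≤ δ) (hdiff : ∀ i j, g i ≠ g j → δ < d i j)
    {P : Finset (Finset (Fin N))} (h : Refines g P) (hcard : K < P.card) :
    ∃ P', AHCStep d P P' ∧ Refines g P' ∧ P'.card + 1 = P.card := by
  obtain ⟨C, hC, C', hC', hne, -⟩ := h.exists_pair hcard
  obtain ⟨⟨A, A'⟩, hAA, hmin⟩ := Finset.exists_min_image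
    ((P ×ˢ P).filter fun p => p.1 ≠ p.2) (fun p => linkage d p.1 p.2)
    ⟨(C, C'), by simp [hC, hC', hne]⟩
  simp only [Finset.mem_filter, Finset.mem_product] at hAA hmin
  have hmin' : ∀ C ∈ P, ∀ C' ∈ P, C ≠ C' → linkage d A A' ≤ linkage d C C' :=
    fun C hC C' hC' hn => hmin (C, C') ⟨⟨hC, hC'⟩, hn⟩
  exact ⟨_, AHCStep.merge P A A' hAA.1.1 hAA.1.2 hAA.2 hmin',
    h.merge hAA.1.1 hAA.1.2 (h.label_of_minimal hsame hdiff hcard hmin'),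
    h.card_merge hAA.1.1 hAA.1.2 hAA.2⟩

lemma exists_output_of_refines {N K : ℕ} [Nonempty (Fin K)] {g : Fin N → Fin K} {d : Fin N → Fin N → ℝ} {δ : ℝ}
    (hsame : ∀ i j, g i = g j → d i j ≤ δ) (hdiff : ∀ i j, g i ≠ g j → δ < d i j) (m : ℕ) :
    ∀ P : Finset (Finset (Fin N)), Refines g P → P.card = K + m →
      ∃ P', Relation.ReflTransGen (AHCStep d) P P' ∧ Refines g P' ∧ P'.card = K := by
  induction m with
  | zero => exact fun P h hc => ⟨P, .refl, h, hc⟩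
  | succ m ih =>
    intro P h hc
    obtain ⟨P₁, hs, h₁, hc₁⟩ := h.exists_step hsame hdiff (by omega)
    obtain ⟨P₂, hs₂, h₂, hc₂⟩ := ih P₁ h₁ (by omega)
    exact ⟨P₂, .head hs hs₂, h₂, hc₂⟩

/-- If a threshold separates the within-group distances from the between-group distances, then
the true partition is the only output of complete-linkage clustering. -/
theorem isAHCOutput_iff_of_separated {N K : ℕ} [Nonempty (Fin K)] {g : Fin N → Fin K} (hg : Function.Surjective g)
    {d : Fin N → Fin N → ℝ} {δ : ℝ}
    (hsame : ∀ i j, g i = g j → d i j ≤ δ) (hdiff : ∀ i j, g i ≠ g j → δ < d i j)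
    (P : Finset (Finset (Fin N))) : IsAHCOutput d K P ↔ P = truePartition g := by
  have hKN : K ≤ N := by simpa using Fintype.card_le_of_surjective g hg
  have hcard0 : (Finset.univ.image fun i : Fin N => ({i} : Finset (Fin N))).card = N := by
    rw [Finset.card_image_of_injective _ (fun a b h => Finset.singleton_injective h)]
    simp
  constructor
  · rintro ⟨hreach, hP⟩
    -- Once fewer than `K` clusters are left the refinement may be lost, but the number of clusters
    -- never grows again, so such a state cannot lead to an output with `K` clusters.
    have inv : (Refines g P ∧ K ≤ P.card) ∨ P.card < K := by
      clear hP
      induction hreach with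
      | refl => exact Or.inl ⟨refines_singletons g, by rw [hcard0]; exact hKN⟩
      | tail _ hstep ih =>
        cases hstep with
        | merge A A' hA hA' hne hmin =>
          have hle := card_merge_le _ (U := A ∪ A') hA hA' hne
          rcases ih with ⟨hr, hK⟩ | hlt
          · rcases hK.eq_or_lt with heq | hK
            · right; omega
            · left
              have := hr.card_merge hA hA' hne
              exact ⟨hr.merge hA hA' (hr.label_of_minimal hsame hdiff hK hmin), by omega⟩
          · right; omega
    rcases inv with ⟨hr, -⟩ | hlt
    · exact hr.eq_truePartition hg hP
    · omega
  · rintro rfl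
    obtain ⟨P', hs, hr, hc⟩ := exists_output_of_refines hsame hdiff (N - K) _
      (refines_singletons g) (by rw [hcard0]; omega)
    rw [← hr.eq_truePartition hg hc]
    exact ⟨hs, hc⟩

/-! ### Euclidean and Frobenius norms -/

section Frobenius

open scoped Matrix.Norms.Frobenius

lemma l2Norm_nonneg {k : ℕ} (v : Fin k → ℝ) : 0 ≤ l2Norm v := norm_nonneg _

lemma l2Norm_sq {k : ℕ} (v : Fin k → ℝ) : l2Norm v ^ 2 = v ⬝ᵥ v := by
  rw [l2Norm, EuclideanSpace.real_norm_sq_eq]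
  simp [dotProduct, sq]

lemma l2Norm_sub_le {k : ℕ} (v w : Fin k → ℝ) : l2Norm (v - w) ≤ l2Norm v + l2Norm w := by
  simpa [l2Norm] using norm_sub_le (WithLp.toLp 2 v) (WithLp.toLp 2 w)

lemma l2Norm_add_le {k : ℕ} (v w : Fin k → ℝ) : l2Norm (v + w) ≤ l2Norm v + l2Norm w := by
  simpa [l2Norm] using norm_add_le (WithLp.toLp 2 v) (WithLp.toLp 2 w)

lemma l2Norm_smul {k : ℕ} (a : ℝ) (v : Fin k → ℝ) : l2Norm (a • v) = |a| * l2Norm v := by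
  simp [l2Norm, norm_smul]

lemma abs_dotProduct_le {k : ℕ} (v w : Fin k → ℝ) : |v ⬝ᵥ w| ≤ l2Norm v * l2Norm w := by
  have := abs_real_inner_le_norm (WithLp.toLp 2 w) (WithLp.toLp 2 v)
  rw [EuclideanSpace.inner_toLp_toLp] at this
  simpa [l2Norm, mul_comm] using this

lemma l2Norm_le_l1Norm {k : ℕ} (v : Fin k → ℝ) : l2Norm v ≤ l1Norm v := by
  have h0 : 0 ≤ l1Norm v := Finset.sum_nonneg fun _ _ => abs_nonneg _
  refine abs_le_of_sq_le_sq' ?_ h0 |>.2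
  rw [l2Norm_sq, l1Norm, dotProduct]
  calc ∑ i, v i * v i = ∑ i, |v i| ^ 2 := by simp [sq]
    _ ≤ (∑ i, |v i|) ^ 2 := Finset.sum_sq_le_sq_sum_of_nonneg fun _ _ => abs_nonneg _

lemma l1Norm_le {k : ℕ} (v : Fin k → ℝ) : l1Norm v ≤ Real.sqrt k * l2Norm v := by
  have h0 : 0 ≤ Real.sqrt k * l2Norm v := mul_nonneg (Real.sqrt_nonneg _) (l2Norm_nonneg v)
  refine abs_le_of_sq_le_sq' ?_ h0 |>.2
  rw [mul_pow, l2Norm_sq, Real.sq_sqrt (Nat.cast_nonneg k), l1Norm, dotProduct]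
  have := sq_sum_le_card_mul_sum_sq (s := (Finset.univ : Finset (Fin k))) (f := fun i => |v i|)
  simpa [sq] using this

lemma norm_sq_eq_sum {m k : ℕ} (A : Matrix (Fin m) (Fin k) ℝ) :
    ‖A‖ ^ 2 = ∑ i, ∑ j, A i j ^ 2 := by
  rw [Matrix.frobenius_norm_def, ← Real.sqrt_eq_rpow, Real.sq_sqrt]
  · simp
  · positivity

lemma norm_sq_eq_trace {m k : ℕ} (A : Matrix (Fin m) (Fin k) ℝ) : ‖A‖ ^ 2 = (Aᵀ * A).trace := by
  rw [norm_sq_eq_sum, Finset.sum_comm]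
  simp [Matrix.trace, Matrix.mul_apply, sq]

lemma frobNorm_eq_norm {m k : ℕ} (A : Matrix (Fin m) (Fin k) ℝ) : frobNorm A = ‖A‖ := by
  rw [frobNorm, ← norm_sq_eq_trace, Real.sqrt_sq (norm_nonneg _)]

lemma norm_replicateCol_eq {m : ℕ} (v : Fin m → ℝ) :
    ‖Matrix.replicateCol (Fin 1) v‖ = l2Norm v :=
  Matrix.frobenius_norm_replicateCol v

lemma l2Norm_mulVec_le {m k : ℕ} (A : Matrix (Fin m) (Fin k) ℝ) (v : Fin k → ℝ) :
    l2Norm (A *ᵥ v) ≤ ‖A‖ * l2Norm v := by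
  have h := Matrix.frobenius_norm_mul A (Matrix.replicateCol (Fin 1) v)
  rwa [← Matrix.replicateCol_mulVec, norm_replicateCol_eq, norm_replicateCol_eq] at h

lemma l2Norm_row_le {m k : ℕ} (A : Matrix (Fin m) (Fin k) ℝ) (i : Fin m) :
    l2Norm (A i) ≤ ‖A‖ := by
  refine abs_le_of_sq_le_sq' ?_ (norm_nonneg _) |>.2
  rw [l2Norm_sq, norm_sq_eq_sum]
  refine le_trans (le_of_eq ?_) (Finset.single_le_sum (f := fun i => ∑ j, A i j ^ 2)
    (fun i _ => by positivity) (Finset.mem_univ i))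
  simp [dotProduct, sq]

lemma norm_sq_eq_sum_col {m k : ℕ} (A : Matrix (Fin m) (Fin k) ℝ) :
    ‖A‖ ^ 2 = ∑ j, l2Norm (fun i => A i j) ^ 2 := by
  rw [norm_sq_eq_sum, Finset.sum_comm]
  exact Finset.sum_congr rfl fun j _ => by rw [l2Norm_sq]; simp [dotProduct, sq]

/-- A bound for the action on vectors is a bound for the action on matrices. -/
lemma norm_mul_le_of_mulVec {m k l : ℕ} (P : Matrix (Fin m) (Fin k) ℝ) {c : ℝ}
    (h : ∀ x, l2Norm (P *ᵥ x) ^ 2 ≤ c * l2Norm x ^ 2) (A : Matrix (Fin k) (Fin l) ℝ) :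
    ‖P * A‖ ^ 2 ≤ c * ‖A‖ ^ 2 := by
  rw [norm_sq_eq_sum_col, norm_sq_eq_sum_col, Finset.mul_sum]
  exact Finset.sum_le_sum fun j _ => h fun i => A i j

/-- This is how the eigenvalue matrix is divided out, both in the eigenvalue equation and in the
bound for `Λ_r⁻¹`. -/
lemma norm_mul_diagonal_ge {m k : ℕ} (A : Matrix (Fin m) (Fin k) ℝ) (d : Fin k → ℝ) {c : ℝ}
    (hc : 0 ≤ c) (hd : ∀ l, c ≤ d l) : c * ‖A‖ ≤ ‖A * Matrix.diagonal d‖ := by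
  refine abs_le_of_sq_le_sq' ?_ (norm_nonneg _) |>.2
  rw [mul_pow, norm_sq_eq_sum, norm_sq_eq_sum, Finset.mul_sum]
  refine Finset.sum_le_sum fun i _ => ?_
  rw [Finset.mul_sum]
  refine Finset.sum_le_sum fun j _ => ?_
  rw [Matrix.mul_diagonal, mul_pow, mul_comm]
  exact mul_le_mul_of_nonneg_left (pow_le_pow_left₀ hc (hd j) 2) (sq_nonneg _)

lemma l2Norm_diagonal_mulVec_ge {k : ℕ} (d w : Fin k → ℝ) {c : ℝ}
    (hc : 0 ≤ c) (hd : ∀ l, c ≤ d l) : c * l2Norm w ≤ l2Norm (Matrix.diagonal d *ᵥ w) := by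
  refine abs_le_of_sq_le_sq' ?_ (l2Norm_nonneg _) |>.2
  rw [mul_pow, l2Norm_sq, l2Norm_sq, dotProduct, dotProduct, Finset.mul_sum]
  refine Finset.sum_le_sum fun i _ => ?_
  rw [Matrix.mulVec_diagonal]
  nlinarith [mul_le_mul_of_nonneg_left (pow_le_pow_left₀ hc (hd i) 2) (sq_nonneg (w i))]

/-! ### The penalty matrix -/

lemma laplacian_transpose (N : ℕ) : (laplacian N)ᵀ = laplacian N := by
  rw [laplacian, Matrix.transpose_sub, Matrix.transpose_smul, Matrix.transpose_one]
  rfl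

lemma laplacian_mul_apply {N k : ℕ} (A : Matrix (Fin N) (Fin k) ℝ) (i : Fin N) (l : Fin k) :
    (laplacian N * A) i l = A i l - (1 / (N : ℝ)) * ∑ j, A j l := by
  rw [laplacian, Matrix.sub_mul, Matrix.one_mul, Matrix.sub_apply, Matrix.smul_mul,
    Matrix.smul_apply, Matrix.mul_apply]
  simp

lemma laplacian_mul_self (N : ℕ) : laplacian N * laplacian N = laplacian N := by
  ext i l
  have hN : (N : ℝ) ≠ 0 := Nat.cast_ne_zero.mpr (Nat.pos_iff_ne_zero.mp (i.pos))
  rw [laplacian_mul_apply]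
  suffices h : ∑ j, laplacian N j l = 0 by rw [h]; ring
  simp [laplacian, Matrix.one_apply, Finset.sum_sub_distrib, hN]

lemma penaltyMatrix_inv (N : ℕ) {lam : ℝ} (h : 0 ≤ lam) :
    (penaltyMatrix N lam)⁻¹ = 1 - (lam / (1 + lam)) • laplacian N := by
  refine Matrix.inv_eq_right_inv ?_
  rw [penaltyMatrix, Matrix.mul_sub, Matrix.mul_one, Matrix.mul_smul, Matrix.add_mul,
    Matrix.one_mul, Matrix.smul_mul, laplacian_mul_self]
  have h1 : 1 + lam ≠ 0 := by positivity
  have : lam • laplacian N = (lam / (1 + lam)) • (laplacian N + lam • laplacian N) := by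
    rw [smul_add, smul_smul, ← add_smul]
    congr 1
    field_simp
  rw [← this]
  abel

lemma penaltyMatrix_inv_transpose (N : ℕ) {lam : ℝ} (h : 0 ≤ lam) :
    ((penaltyMatrix N lam)⁻¹)ᵀ = (penaltyMatrix N lam)⁻¹ := by
  rw [penaltyMatrix_inv N h, Matrix.transpose_sub, Matrix.transpose_smul, laplacian_transpose,
    Matrix.transpose_one]

/-- The Laplacian subtracts the same mean from every row, so the mean cancels in differences and `1
- λ/(1+λ) = 1/(1+λ)` remains. The penalty therefore rescales all estimated distances by one factor,
however large `λ` is. -/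
lemma penaltyMatrix_inv_mul_row_sub {N k : ℕ} {lam : ℝ} (h : 0 ≤ lam)
    (A : Matrix (Fin N) (Fin k) ℝ) (i j : Fin N) :
    ((penaltyMatrix N lam)⁻¹ * A) i - ((penaltyMatrix N lam)⁻¹ * A) j
      = (1 / (1 + lam)) • (A i - A j) := by
  have h1 : 1 + lam ≠ 0 := by positivity
  ext l
  rw [penaltyMatrix_inv N h, Matrix.sub_mul, Matrix.one_mul, Matrix.smul_mul]
  simp only [Pi.sub_apply, Matrix.sub_apply, Matrix.smul_apply, laplacian_mul_apply, smul_eq_mul,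
    Pi.smul_apply]
  field_simp
  ring

lemma norm_sub_projection_le {N k : ℕ} (Q : Matrix (Fin N) (Fin N) ℝ) (ht : Qᵀ = Q)
    (hQ : Q * Q = Q) (A : Matrix (Fin N) (Fin k) ℝ) : ‖A - Q * A‖ ≤ ‖A‖ := by
  refine abs_le_of_sq_le_sq' ?_ (norm_nonneg _) |>.2
  have h1 : (A - Q * A)ᵀ * (A - Q * A) + (Q * A)ᵀ * (Q * A) = Aᵀ * A := by
    have h2 : Aᵀ * Q * (Q * A) = Aᵀ * Q * A := by
      rw [← Matrix.mul_assoc, Matrix.mul_assoc Aᵀ, hQ]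
    rw [Matrix.transpose_sub, Matrix.transpose_mul, ht, Matrix.sub_mul, Matrix.mul_sub,
      Matrix.mul_sub, h2, Matrix.mul_assoc Aᵀ Q A]
    abel
  have h3 := congrArg Matrix.trace h1
  rw [Matrix.trace_add, ← norm_sq_eq_trace, ← norm_sq_eq_trace, ← norm_sq_eq_trace] at h3
  nlinarith [sq_nonneg ‖Q * A‖]

/-- `D⁻¹` is a convex combination of the identity and the projection `1 - Π_N`, both of which are
contractions. -/
lemma norm_penaltyMatrix_inv_mul_le {N k : ℕ} {lam : ℝ} (h : 0 ≤ lam)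
    (A : Matrix (Fin N) (Fin k) ℝ) : ‖(penaltyMatrix N lam)⁻¹ * A‖ ≤ ‖A‖ := by
  have h1 : 0 < 1 + lam := by positivity
  have hθ : 0 ≤ lam / (1 + lam) := by positivity
  have hθ' : 0 ≤ 1 - lam / (1 + lam) := by
    rw [sub_nonneg, div_le_one h1]; linarith
  have h2 : (penaltyMatrix N lam)⁻¹ * A
      = (1 - lam / (1 + lam)) • A + (lam / (1 + lam)) • (A - laplacian N * A) := by
    rw [penaltyMatrix_inv N h, Matrix.sub_mul, Matrix.one_mul, Matrix.smul_mul, sub_smul,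
      one_smul, smul_sub]
    abel
  have h3 := norm_sub_projection_le _ (laplacian_transpose N) (laplacian_mul_self N) A
  rw [h2]
  calc _ ≤ (1 - lam / (1 + lam)) * ‖A‖ + (lam / (1 + lam)) * ‖A - laplacian N * A‖ := by
        refine (norm_add_le _ _).trans (le_of_eq ?_)
        rw [norm_smul, norm_smul, Real.norm_of_nonneg hθ, Real.norm_of_nonneg hθ']
    _ ≤ (1 - lam / (1 + lam)) * ‖A‖ + (lam / (1 + lam)) * ‖A‖ := by gcongr
    _ = ‖A‖ := by ring

lemma norm_mul_penaltyMatrix_inv_le {N k : ℕ} {lam : ℝ} (h : 0 ≤ lam)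
    (A : Matrix (Fin k) (Fin N) ℝ) : ‖A * (penaltyMatrix N lam)⁻¹‖ ≤ ‖A‖ := by
  rw [← Matrix.frobenius_norm_transpose, Matrix.transpose_mul, penaltyMatrix_inv_transpose N h,
    ← Matrix.frobenius_norm_transpose A]
  exact norm_penaltyMatrix_inv_mul_le h _

lemma l2Norm_penaltyMatrix_inv_mulVec_le {N : ℕ} {lam : ℝ} (h : 0 ≤ lam) (v : Fin N → ℝ) :
    l2Norm ((penaltyMatrix N lam)⁻¹ *ᵥ v) ≤ l2Norm v := by
  have := norm_penaltyMatrix_inv_mul_le h (Matrix.replicateCol (Fin 1) v)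
  rwa [← Matrix.replicateCol_mulVec, norm_replicateCol_eq, norm_replicateCol_eq] at this

lemma dotProduct_laplacian_mulVec {N : ℕ} (a : Fin N → ℝ) :
    a ⬝ᵥ laplacian N *ᵥ a = l2Norm (laplacian N *ᵥ a) ^ 2 := by
  rw [l2Norm_sq]
  conv_lhs => rw [← laplacian_mul_self, ← Matrix.mulVec_mulVec, Matrix.dotProduct_mulVec,
    ← Matrix.mulVec_transpose, laplacian_transpose]

lemma dotProduct_penaltyMatrix_inv {N : ℕ} {lam : ℝ} (h : 0 ≤ lam) (a : Fin N → ℝ) :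
    a ⬝ᵥ (penaltyMatrix N lam)⁻¹ *ᵥ a
      = l2Norm a ^ 2 - lam / (1 + lam) * l2Norm (laplacian N *ᵥ a) ^ 2 := by
  rw [penaltyMatrix_inv N h, Matrix.sub_mulVec, Matrix.one_mulVec, dotProduct_sub, ← l2Norm_sq,
    Matrix.smul_mulVec, dotProduct_smul, smul_eq_mul, dotProduct_laplacian_mulVec]

lemma dotProduct_penaltyMatrix_inv_nonneg {N : ℕ} {lam : ℝ} (h : 0 ≤ lam) (a : Fin N → ℝ) :
    0 ≤ a ⬝ᵥ (penaltyMatrix N lam)⁻¹ *ᵥ a := by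
  have h1 : lam / (1 + lam) ≤ 1 := by
    rw [div_le_one (by positivity)]; linarith
  have h2 : l2Norm (laplacian N *ᵥ a) ^ 2 ≤ l2Norm a ^ 2 := by
    rw [← dotProduct_laplacian_mulVec]
    have h4 := sq_nonneg (l2Norm (laplacian N *ᵥ a))
    have h3 : 0 ≤ l2Norm (a - laplacian N *ᵥ a) ^ 2 := sq_nonneg _
    rw [l2Norm_sq, sub_dotProduct, dotProduct_sub, dotProduct_sub, ← l2Norm_sq, ← l2Norm_sq,
      dotProduct_comm (laplacian N *ᵥ a) a, dotProduct_laplacian_mulVec] at h3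
    rw [dotProduct_laplacian_mulVec]
    linarith
  rw [dotProduct_penaltyMatrix_inv h]
  nlinarith [sq_nonneg (l2Norm (laplacian N *ᵥ a)),
    mul_le_mul_of_nonneg_right h1 (sq_nonneg (l2Norm (laplacian N *ᵥ a)))]

/-- Here `a` plays the signal and `b` the noise. The term quadratic in `b` is nonnegative and
dropped, the cross term is bounded by Cauchy-Schwarz and contractivity of `D⁻¹`, and `λ/(1+λ) ≤ λ`
is used to match the assumption on `λ‖B*‖²`. -/
lemma dotProduct_penaltyMatrix_inv_add_ge {N : ℕ} {lam : ℝ} (h : 0 ≤ lam) (a b : Fin N → ℝ) :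
    l2Norm a ^ 2 - lam * l2Norm (laplacian N *ᵥ a) ^ 2 - 2 * (l2Norm a * l2Norm b)
      ≤ (a + b) ⬝ᵥ (penaltyMatrix N lam)⁻¹ *ᵥ (a + b) := by
  have h1 : lam / (1 + lam) ≤ lam := by
    rw [div_le_iff₀ (by positivity)]; nlinarith
  have hsym : a ⬝ᵥ (penaltyMatrix N lam)⁻¹ *ᵥ b = b ⬝ᵥ (penaltyMatrix N lam)⁻¹ *ᵥ a := by
    rw [Matrix.dotProduct_mulVec, ← Matrix.mulVec_transpose, penaltyMatrix_inv_transpose N h,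
      dotProduct_comm]
  have h2 := abs_dotProduct_le b ((penaltyMatrix N lam)⁻¹ *ᵥ a)
  have h3 := mul_le_mul_of_nonneg_left (l2Norm_penaltyMatrix_inv_mulVec_le h a) (l2Norm_nonneg b)
  have h4 := neg_abs_le (b ⬝ᵥ (penaltyMatrix N lam)⁻¹ *ᵥ a)
  have h5 := dotProduct_penaltyMatrix_inv_nonneg h b
  rw [Matrix.mulVec_add, add_dotProduct, dotProduct_add, dotProduct_add, hsym,
    dotProduct_penaltyMatrix_inv h a]
  nlinarith [mul_le_mul_of_nonneg_right h1 (sq_nonneg (l2Norm (laplacian N *ᵥ a)))]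

/-! ### Eigenvalue bounds -/

lemma dotProduct_self_eq_sum {m : ℕ} {A : Matrix (Fin m) (Fin m) ℝ} (hA : A.IsHermitian)
    (x : Fin m → ℝ) : x ⬝ᵥ x = ∑ i, ((hA.eigenvectorBasis i).ofLp ⬝ᵥ x) ^ 2 := by
  have h := hA.eigenvectorBasis.sum_inner_mul_inner (WithLp.toLp 2 x) (WithLp.toLp 2 x)
  rw [EuclideanSpace.inner_toLp_toLp] at h
  simp only [star_trivial] at h
  rw [← h]
  refine Finset.sum_congr rfl fun i _ => ?_
  rw [EuclideanSpace.inner_eq_star_dotProduct, EuclideanSpace.inner_eq_star_dotProduct]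
  simp only [star_trivial]
  rw [dotProduct_comm x, sq]

lemma dotProduct_mulVec_eq_sum {m : ℕ} {A : Matrix (Fin m) (Fin m) ℝ} (hA : A.IsHermitian)
    (x : Fin m → ℝ) :
    x ⬝ᵥ A *ᵥ x = ∑ i, hA.eigenvalues i * ((hA.eigenvectorBasis i).ofLp ⬝ᵥ x) ^ 2 := by
  have h := hA.eigenvectorBasis.sum_inner_mul_inner (WithLp.toLp 2 x) (WithLp.toLp 2 (A *ᵥ x))
  rw [EuclideanSpace.inner_toLp_toLp] at h
  simp only [star_trivial] at h
  rw [dotProduct_comm, ← h]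
  refine Finset.sum_congr rfl fun i _ => ?_
  rw [EuclideanSpace.inner_eq_star_dotProduct, EuclideanSpace.inner_eq_star_dotProduct]
  simp only [star_trivial]
  have ht : Aᵀ = A := by simpa [Matrix.IsHermitian] using hA
  have h2 : (A *ᵥ x) ⬝ᵥ (hA.eigenvectorBasis i).ofLp
      = hA.eigenvalues i * ((hA.eigenvectorBasis i).ofLp ⬝ᵥ x) := by
    rw [dotProduct_comm, Matrix.dotProduct_mulVec, ← Matrix.mulVec_transpose, ht,
      hA.mulVec_eigenvectorBasis, smul_dotProduct, smul_eq_mul]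
  rw [h2]
  ring

/-- The lower half of the Courant-Fischer principle for the eigenvalues in decreasing order. -/
lemma le_eigDesc {m r : ℕ} {A : Matrix (Fin m) (Fin m) ℝ} (hA : A.IsHermitian) {c : ℝ}
    (Φ : Matrix (Fin m) (Fin r) ℝ) (hΦ : ∀ u, Φ *ᵥ u = 0 → u = 0)
    (h : ∀ u, c * l2Norm (Φ *ᵥ u) ^ 2 ≤ (Φ *ᵥ u) ⬝ᵥ A *ᵥ (Φ *ᵥ u)) {l : ℕ} (hl : l < r)
    (hlm : l < m) : c ≤ eigDesc A l := by
  rw [eigDesc, dif_pos ⟨hA, hlm⟩]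
  have hlm' : l < Fintype.card (Fin m) := by simpa using hlm
  set σ : Fin (Fintype.card (Fin m)) ≃ Fin m := Fintype.equivOfCardEq (Fintype.card_fin _)
  let f : (Fin r → ℝ) →ₗ[ℝ] (Fin l → ℝ) :=
    (Matrix.of fun (k : Fin l) => (hA.eigenvectorBasis (σ ⟨k, k.2.trans hlm'⟩)).ofLp).mulVecLin ∘ₗ
      Φ.mulVecLin
  -- Orthogonality to the `l` leading eigenvectors imposes `l < r` linear conditions on `u`, so a
  -- nonzero solution is left. On it the quadratic form is at most the eigenvalue with index `l`,
  -- counted from zero.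
  have hker : LinearMap.ker f ≠ ⊥ := LinearMap.ker_ne_bot_of_finrank_lt (by simpa using hl)
  obtain ⟨u, hu, hu0⟩ := Submodule.exists_mem_ne_zero_of_ne_bot hker
  rw [LinearMap.mem_ker] at hu
  set x := Φ *ᵥ u with hx
  have hx0 : x ≠ 0 := fun h0 => hu0 (hΦ u h0)
  have hxx : 0 < x ⬝ᵥ x := by
    rcases (dotProduct_self_star_nonneg x).lt_or_eq with h0 | h0
    · simpa using h0
    · exact absurd (dotProduct_self_eq_zero.mp (by simpa using h0.symm)) hx0
  have horth : ∀ k (hk : k < l),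
      (hA.eigenvectorBasis (σ ⟨k, hk.trans hlm'⟩)).ofLp ⬝ᵥ x = 0 :=
    fun k hk => congrFun hu ⟨k, hk⟩
  have hle : x ⬝ᵥ A *ᵥ x ≤ hA.eigenvalues₀ ⟨l, hlm'⟩ * (x ⬝ᵥ x) := by
    rw [dotProduct_mulVec_eq_sum hA, dotProduct_self_eq_sum hA x, Finset.mul_sum]
    refine Finset.sum_le_sum fun i _ => ?_
    obtain ⟨k, rfl⟩ := σ.surjective i
    by_cases hk : k.1 < l
    · rw [show k = ⟨k.1, hk.trans hlm'⟩ from rfl, horth k.1 hk]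
      simp
    · refine mul_le_mul_of_nonneg_right ?_ (sq_nonneg _)
      have : hA.eigenvalues (σ k) = hA.eigenvalues₀ k := by
        rw [Matrix.IsHermitian.eigenvalues]
        congr 1
        exact σ.symm_apply_apply k
      rw [this]
      exact hA.eigenvalues₀_antitone (by simpa [Fin.le_def] using hk)
  have h1 := h u
  rw [l2Norm_sq] at h1
  exact le_of_mul_le_mul_right (h1.trans hle) hxx

lemma l2Norm_mulVec_sq_le_of_eigDesc {m : ℕ} {P : Matrix (Fin m) (Fin m) ℝ} {c : ℝ}
    (h : ∀ j < m, eigDesc (Pᵀ * P) j ≤ c) (x : Fin m → ℝ) :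
    l2Norm (P *ᵥ x) ^ 2 ≤ c * l2Norm x ^ 2 := by
  have hA : (Pᵀ * P).IsHermitian := by
    simpa using Matrix.isHermitian_conjTranspose_mul_self P
  have heq : l2Norm (P *ᵥ x) ^ 2 = x ⬝ᵥ (Pᵀ * P) *ᵥ x := by
    rw [l2Norm_sq, ← Matrix.mulVec_mulVec, Matrix.dotProduct_mulVec x, Matrix.vecMul_transpose]
  rw [heq, l2Norm_sq, dotProduct_mulVec_eq_sum hA, dotProduct_self_eq_sum hA x, Finset.mul_sum]
  refine Finset.sum_le_sum fun i _ => mul_le_mul_of_nonneg_right ?_ (sq_nonneg _)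
  set σ : Fin (Fintype.card (Fin m)) ≃ Fin m := Fintype.equivOfCardEq (Fintype.card_fin _)
  have hi : (σ.symm i).1 < m := by simpa using (σ.symm i).2
  have := h _ hi
  rw [eigDesc, dif_pos ⟨hA, hi⟩] at this
  exact this

/-- `‖Pᵀy‖² = ⟨y, PPᵀy⟩ ≤ ‖y‖ ‖PPᵀy‖`; squaring, applying the bound for `P` to `Pᵀy` and cancelling
`‖Pᵀy‖²` gives the claim. -/
lemma l2Norm_transpose_mulVec_sq_le {m k : ℕ} {P : Matrix (Fin m) (Fin k) ℝ} {c : ℝ}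
    (hc : 0 ≤ c) (h : ∀ x, l2Norm (P *ᵥ x) ^ 2 ≤ c * l2Norm x ^ 2) (y : Fin m → ℝ) :
    l2Norm (Pᵀ *ᵥ y) ^ 2 ≤ c * l2Norm y ^ 2 := by
  have h1 : l2Norm (Pᵀ *ᵥ y) ^ 2 = y ⬝ᵥ P *ᵥ (Pᵀ *ᵥ y) := by
    rw [l2Norm_sq, Matrix.dotProduct_mulVec y, Matrix.mulVec_transpose]
  have h2 := (le_abs_self _).trans (abs_dotProduct_le y (P *ᵥ (Pᵀ *ᵥ y)))
  have h3 := h (Pᵀ *ᵥ y)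
  rw [← h1] at h2
  set a := l2Norm (Pᵀ *ᵥ y)
  set b := l2Norm (P *ᵥ (Pᵀ *ᵥ y))
  set d := l2Norm y
  rcases (sq_nonneg a).eq_or_lt with h0 | h0
  · rw [← h0]
    positivity
  · have h4 : a ^ 2 * a ^ 2 ≤ d ^ 2 * (c * a ^ 2) := by
      calc a ^ 2 * a ^ 2 ≤ (d * b) * (d * b) := mul_self_le_mul_self h0.le h2
        _ = d ^ 2 * b ^ 2 := by ring
        _ ≤ _ := by gcongr
    nlinarith

lemma dotProduct_mulVec_ge_of_eigenvalues {m : ℕ} {A : Matrix (Fin m) (Fin m) ℝ}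
    (hA : A.IsHermitian) {c : ℝ} (h : ∀ i, c ≤ hA.eigenvalues i) (x : Fin m → ℝ) :
    c * l2Norm x ^ 2 ≤ x ⬝ᵥ A *ᵥ x := by
  rw [l2Norm_sq, dotProduct_mulVec_eq_sum hA, dotProduct_self_eq_sum hA x, Finset.mul_sum]
  exact Finset.sum_le_sum fun i _ => mul_le_mul_of_nonneg_right (h i) (sq_nonneg _)

end Frobenius

/-! ### Second moments of quadratic forms in independent entries -/

section Moments

open scoped Matrix.Norms.Frobenius

variable {Ω : Type*} [MeasurableSpace Ω] {μ : Measure Ω}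

/-- Markov's inequality through a dominating variable, so that only `g`, and not `f`, has to be
integrable. -/
lemma measure_gt_le_of_integral_le [IsFiniteMeasure μ] {f g : Ω → ℝ} (hfg : ∀ᵐ ω ∂μ, f ω ≤ g ω)
    (hg0 : ∀ ω, 0 ≤ g ω) (hg : Integrable g μ) {k η : ℝ} (hk : 0 < k)
    (hK : ∫ ω, g ω ∂μ ≤ η * k) : μ {ω | k < f ω} ≤ ENNReal.ofReal η := by
  have h1 : μ {ω | k < f ω} ≤ μ {ω | k ≤ g ω} := by
    refine measure_mono_ae ?_
    filter_upwards [hfg] with ω hω hk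
    exact (le_of_lt hk).trans hω
  have h2 := mul_meas_ge_le_integral_of_nonneg (Eventually.of_forall hg0) hg k
  refine h1.trans ?_
  rw [← ofReal_measureReal]
  refine ENNReal.ofReal_le_ofReal ?_
  have h3 := h2.trans hK
  nlinarith

/-- After expansion of the square, independence factors each expectation and orthonormality of the
`s t` kills the cross terms. Every second-moment computation below, with deterministic or random
coefficients, is an instance. -/
lemma integral_sq_sum_mul {ι : Type*} [Fintype ι] [DecidableEq ι] {a s : ι → Ω → ℝ}
    (ha : ∀ t, MemLp (a t) 2 μ) (hs : ∀ t, MemLp (s t) 2 μ)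
    (hind : IndepFun (fun ω t => a t ω) (fun ω t => s t ω) μ)
    (horth : ∀ t u, ∫ ω, s t ω * s u ω ∂μ = if t = u then 1 else 0) :
    Integrable (fun ω => (∑ t, a t ω * s t ω) ^ 2) μ ∧
      ∫ ω, (∑ t, a t ω * s t ω) ^ 2 ∂μ = ∑ t, ∫ ω, a t ω ^ 2 ∂μ := by
  have hexp : (fun ω => (∑ t, a t ω * s t ω) ^ 2)
      = fun ω => ∑ t, ∑ u, (a t ω * a u ω) * (s t ω * s u ω) := by
    funext ω
    rw [sq, Finset.sum_mul_sum]
    exact Finset.sum_congr rfl fun t _ => Finset.sum_congr rfl fun u _ => by ring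
  have hind' : ∀ t u, IndepFun (fun ω => a t ω * a u ω) (fun ω => s t ω * s u ω) μ :=
    fun t u => hind.comp (φ := fun x : ι → ℝ => x t * x u) (ψ := fun x : ι → ℝ => x t * x u)
      (by fun_prop) (by fun_prop)
  have hai : ∀ t u, Integrable (fun ω => a t ω * a u ω) μ := fun t u => (ha t).integrable_mul (ha u)
  have hsi : ∀ t u, Integrable (fun ω => s t ω * s u ω) μ := fun t u => (hs t).integrable_mul (hs u)
  have hint : ∀ t u, Integrable (fun ω => (a t ω * a u ω) * (s t ω * s u ω)) μ :=
    fun t u => (hind' t u).integrable_mul (hai t u) (hsi t u)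
  rw [hexp]
  refine ⟨integrable_finsetSum _ fun t _ => integrable_finsetSum _ fun u _ => hint t u, ?_⟩
  rw [integral_finsetSum _ fun t _ => integrable_finsetSum _ fun u _ => hint t u]
  refine Finset.sum_congr rfl fun t _ => ?_
  rw [integral_finsetSum _ fun u _ => hint t u, Finset.sum_eq_single t]
  · rw [(hind' t t).integral_fun_mul_eq_mul_integral (hai t t).aestronglyMeasurable
      (hsi t t).aestronglyMeasurable, horth, if_pos rfl, mul_one]
    simp [sq]
  · intro u _ hu
    rw [(hind' t u).integral_fun_mul_eq_mul_integral (hai t u).aestronglyMeasurable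
      (hsi t u).aestronglyMeasurable, horth, if_neg hu.symm, mul_zero]
  · simp

/-- The entries of the random matrix `S` are independent, centred, with unit variance and fourth
moments at most `M`. -/
structure IsNoise (μ : Measure Ω) {T N : ℕ} (S : Ω → Matrix (Fin T) (Fin N) ℝ) (M : ℝ) : Prop where
  measurable : ∀ t j, Measurable fun ω => S ω t j
  indep : iIndepFun (fun (p : Fin T × Fin N) ω => S ω p.1 p.2) μ
  memLp : ∀ t j, MemLp (fun ω => S ω t j) 4 μ
  mean : ∀ t j, ∫ ω, S ω t j ∂μ = 0
  variance : ∀ t j, ∫ ω, S ω t j ^ 2 ∂μ = 1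
  fourth : ∀ t j, ∫ ω, S ω t j ^ 4 ∂μ ≤ M

namespace IsNoise

variable {T N : ℕ} {S : Ω → Matrix (Fin T) (Fin N) ℝ} {M : ℝ}

lemma integral_mul (h : IsNoise μ S M) (p q : Fin T × Fin N) :
    ∫ ω, S ω p.1 p.2 * S ω q.1 q.2 ∂μ = if p = q then 1 else 0 := by
  split_ifs with hpq
  · subst hpq
    simpa [sq] using h.variance p.1 p.2
  · rw [(h.indep.indepFun hpq).integral_fun_mul_eq_mul_integral
      (h.measurable _ _).aestronglyMeasurable (h.measurable _ _).aestronglyMeasurable,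
      h.mean, zero_mul]

lemma integral_col_mul (h : IsNoise μ S M) (j : Fin N) (t u : Fin T) :
    ∫ ω, S ω t j * S ω u j ∂μ = if t = u then 1 else 0 := by
  simpa using h.integral_mul (t, j) (u, j)

lemma integral_row_mul (h : IsNoise μ S M) (t : Fin T) (j k : Fin N) :
    ∫ ω, S ω t j * S ω t k ∂μ = if j = k then 1 else 0 := by
  simpa using h.integral_mul (t, j) (t, k)

lemma integrable_pow_four (h : IsNoise μ S M) (t : Fin T) (j : Fin N) :
    Integrable (fun ω => S ω t j ^ 4) μ := by
  have := (h.memLp t j).integrable_norm_pow (p := 4) (by norm_num)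
  refine this.congr (Eventually.of_forall fun ω => ?_)
  simp only [Real.norm_eq_abs]
  exact (by decide : Even 4).pow_abs _

/-- A combination of the columns of `S` other than the `i`-th is independent of the `i`-th. -/
lemma indepFun_col (h : IsNoise μ S M) (A : Matrix (Fin T) (Fin T) ℝ) {w : Fin N → ℝ}
    {i : Fin N} (hw : w i = 0) :
    IndepFun (fun ω t => (A *ᵥ (S ω *ᵥ w)) t) (fun ω t => S ω t i) μ := by
  let I : Finset (Fin T × Fin N) := Finset.univ.filter fun p => p.2 ≠ i
  let J : Finset (Fin T × Fin N) := Finset.univ.filter fun p => p.2 = i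
  have hIJ : Disjoint I J := by
    rw [Finset.disjoint_filter]
    exact fun p _ h1 h2 => h1 h2
  have hind := h.indep.indepFun_finset I J hIJ fun p => h.measurable p.1 p.2
  -- Entries of column `i` are not among the coordinates in `I`; the default `0` is correct there
  -- because `w i = 0`.
  let φ : (I → ℝ) → (Fin T → ℝ) := fun x =>
    A *ᵥ fun t => ∑ j, if hj : j ≠ i then x ⟨(t, j), by simp [I, hj]⟩ * w j else 0
  let ψ : (J → ℝ) → (Fin T → ℝ) := fun x t => x ⟨(t, i), by simp [J]⟩
  have hφ : Measurable φ := by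
    refine measurable_pi_lambda _ fun t => ?_
    simp only [φ, Matrix.mulVec, dotProduct]
    refine Finset.measurable_sum _ fun u _ => Measurable.const_mul ?_ _
    refine Finset.measurable_sum _ fun j _ => ?_
    split_ifs
    · fun_prop
    · fun_prop
  have hψ : Measurable ψ := by
    refine measurable_pi_lambda _ fun t => ?_
    simp only [ψ]
    fun_prop
  have heq : (fun ω t => (A *ᵥ (S ω *ᵥ w)) t)
      = φ ∘ fun ω (p : I) => S ω p.1.1 p.1.2 := by
    funext ω t
    simp only [φ, Function.comp]
    congr 2
    funext u
    simp only [Matrix.mulVec, dotProduct]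
    refine Finset.sum_congr rfl fun j _ => ?_
    split_ifs with hj
    · rfl
    · rw [not_not] at hj
      rw [hj, hw, mul_zero]
  rw [heq]
  exact hind.comp hφ hψ

variable [IsProbabilityMeasure μ]

lemma memLp_two (h : IsNoise μ S M) (t : Fin T) (j : Fin N) :
    MemLp (fun ω => S ω t j) 2 μ :=
  (h.memLp t j).mono_exponent (by norm_num)

lemma integrable_norm_sq (h : IsNoise μ S M) : Integrable (fun ω => ‖S ω‖ ^ 2) μ := by
  simp only [norm_sq_eq_sum]
  exact integrable_finsetSum _ fun t _ => integrable_finsetSum _ fun j _ =>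
    (h.memLp_two t j).integrable_sq

lemma integral_norm_sq (h : IsNoise μ S M) : ∫ ω, ‖S ω‖ ^ 2 ∂μ = T * N := by
  simp only [norm_sq_eq_sum]
  rw [integral_finsetSum _ fun t _ => integrable_finsetSum _ fun j _ =>
    (h.memLp_two t j).integrable_sq]
  simp_rw [integral_finsetSum _ fun j _ => (h.memLp_two _ j).integrable_sq, h.variance]
  simp

lemma memLp_mulVec (h : IsNoise μ S M) (w : Fin N → ℝ) (t : Fin T) :
    MemLp (fun ω => (S ω *ᵥ w) t) 2 μ := by
  simp only [Matrix.mulVec, dotProduct]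
  exact memLp_finsetSum _ fun j _ => by
    simpa [mul_comm] using (h.memLp_two t j).const_mul (w j)

lemma memLp_mulVec_mulVec (h : IsNoise μ S M) (A : Matrix (Fin T) (Fin T) ℝ) (w : Fin N → ℝ)
    (t : Fin T) : MemLp (fun ω => (A *ᵥ (S ω *ᵥ w)) t) 2 μ := by
  simp only [Matrix.mulVec_mulVec]
  simp only [Matrix.mulVec, dotProduct, Matrix.mul_apply, Finset.sum_mul]
  refine memLp_finsetSum _ fun j _ => memLp_finsetSum _ fun u _ => ?_
  have := (h.memLp_two u j).const_mul (A t u * w j)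
  refine this.ae_eq (Eventually.of_forall fun ω => ?_)
  simp only
  ring

lemma integral_l2Norm_mulVec_sq (h : IsNoise μ S M) (w : Fin N → ℝ) :
    ∫ ω, l2Norm (S ω *ᵥ w) ^ 2 ∂μ = T * l2Norm w ^ 2 := by
  have hrow : ∀ t, ∫ ω, (S ω *ᵥ w) t ^ 2 ∂μ = l2Norm w ^ 2 := by
    intro t
    have := (integral_sq_sum_mul (μ := μ) (a := fun j _ => w j) (s := fun j ω => S ω t j)
      (fun j => memLp_const _) (fun j => h.memLp_two t j) (indepFun_const_left _ _)
      (h.integral_row_mul t)).2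
    rw [l2Norm_sq]
    simpa [Matrix.mulVec, dotProduct, sq, mul_comm] using this
  simp only [l2Norm_sq, dotProduct, ← sq] at hrow ⊢
  rw [integral_finsetSum _ fun t _ => (h.memLp_mulVec w t).integrable_sq]
  simp [hrow]

/-- The part of a quadratic form in the columns of `S` that comes from two distinct columns. -/
lemma integral_offDiag_sq_le (h : IsNoise μ S M) {A : Matrix (Fin T) (Fin T) ℝ} {κ : ℝ}
    (hA : ∀ x, l2Norm (A *ᵥ x) ^ 2 ≤ κ * l2Norm x ^ 2) {w : Fin N → ℝ} {i : Fin N}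
    (hw : w i = 0) :
    Integrable (fun ω => ((fun t => S ω t i) ⬝ᵥ A *ᵥ (S ω *ᵥ w)) ^ 2) μ ∧
      ∫ ω, ((fun t => S ω t i) ⬝ᵥ A *ᵥ (S ω *ᵥ w)) ^ 2 ∂μ ≤ κ * (T * l2Norm w ^ 2) := by
  have h1 := integral_sq_sum_mul (μ := μ) (a := fun t ω => (A *ᵥ (S ω *ᵥ w)) t)
    (s := fun t ω => S ω t i) (h.memLp_mulVec_mulVec A w) (fun t => h.memLp_two t i)
    (h.indepFun_col A hw) (h.integral_col_mul i)
  simp only [dotProduct_comm (fun t => S _ t i)]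
  refine ⟨h1.1, ?_⟩
  refine h1.2.le.trans ?_
  rw [← integral_finsetSum _ fun t _ => (h.memLp_mulVec_mulVec A w t).integrable_sq,
    ← h.integral_l2Norm_mulVec_sq, ← integral_const_mul]
  refine integral_mono ?_ ?_ fun ω => ?_
  · exact integrable_finsetSum _ fun t _ => (h.memLp_mulVec_mulVec A w t).integrable_sq
  · simp only [l2Norm_sq, dotProduct, ← sq]
    exact (integrable_finsetSum _ fun t _ => (h.memLp_mulVec w t).integrable_sq).const_mul _
  · have := hA (S ω *ᵥ w)
    rw [l2Norm_sq] at this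
    simpa [dotProduct, sq] using this

/-- Cauchy-Schwarz twice: once for the quadratic form and once as `(∑ x_t²)² ≤ T ∑ x_t⁴`, which
leaves only fourth moments to be controlled. -/
lemma diag_sq_le {A : Matrix (Fin T) (Fin T) ℝ} {κ : ℝ} (hκ : 0 ≤ κ)
    (hA : ∀ x, l2Norm (A *ᵥ x) ^ 2 ≤ κ * l2Norm x ^ 2) (x : Fin T → ℝ) :
    (x ⬝ᵥ A *ᵥ x) ^ 2 ≤ κ * (T * ∑ t, x t ^ 4) := by
  have h1 : (x ⬝ᵥ A *ᵥ x) ^ 2 ≤ (l2Norm x * l2Norm (A *ᵥ x)) ^ 2 := by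
    rw [← sq_abs]
    exact pow_le_pow_left₀ (abs_nonneg _) (abs_dotProduct_le _ _) 2
  have h2 : (l2Norm x ^ 2) ^ 2 ≤ T * ∑ t, x t ^ 4 := by
    have := sq_sum_le_card_mul_sum_sq (s := (Finset.univ : Finset (Fin T)))
      (f := fun t => x t ^ 2)
    rw [l2Norm_sq, dotProduct]
    simpa [← pow_mul, ← sq] using this
  calc _ ≤ _ := h1
    _ = l2Norm x ^ 2 * l2Norm (A *ᵥ x) ^ 2 := by ring
    _ ≤ l2Norm x ^ 2 * (κ * l2Norm x ^ 2) := by gcongr; exact hA x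
    _ = κ * (l2Norm x ^ 2) ^ 2 := by ring
    _ ≤ _ := by gcongr

/-- An integrable bound for `‖SᵀASw‖²`. -/
lemma exists_bound_gram_mulVec (h : IsNoise μ S M) {A : Matrix (Fin T) (Fin T) ℝ} {κ : ℝ}
    (hκ : 0 ≤ κ) (hA : ∀ x, l2Norm (A *ᵥ x) ^ 2 ≤ κ * l2Norm x ^ 2) (w : Fin N → ℝ) :
    ∃ G : Ω → ℝ, Integrable G μ ∧ (∀ ω, l2Norm ((S ω)ᵀ *ᵥ A *ᵥ S ω *ᵥ w) ^ 2 ≤ G ω) ∧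
      ∫ ω, G ω ∂μ ≤ 2 * κ * (N * T + T ^ 2 * M) * l2Norm w ^ 2 := by
  -- Coordinate `i` of `SᵀASw` pairs column `i` with all columns. Zeroing the weight `w i` separates
  -- the part that is independent of column `i`, of second moment at most `κT‖w‖²`, from the
  -- diagonal term `w i (xᵀAx)`, of second moment at most `κT²M w_i²`. Summed over `i` these give
  -- the `NT` and `T²M` of the bound.
  let w' : Fin N → Fin N → ℝ := fun i => Function.update w i 0
  have hw' : ∀ i, w' i i = 0 := fun i => Function.update_self ..
  have hoff := fun i => h.integral_offDiag_sq_le hA (hw' i)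
  have hint4 : ∀ i, Integrable (fun ω => w i ^ 2 * (κ * (T * ∑ t, S ω t i ^ 4))) μ := fun i =>
    (((integrable_finsetSum _ fun t _ => h.integrable_pow_four t i).const_mul _).const_mul
      _).const_mul _
  have hint : ∀ i, Integrable (fun ω => 2 * (((fun t => S ω t i) ⬝ᵥ A *ᵥ (S ω *ᵥ w' i)) ^ 2
      + w i ^ 2 * (κ * (T * ∑ t, S ω t i ^ 4)))) μ := fun i =>
    ((hoff i).1.add (hint4 i)).const_mul 2
  refine ⟨fun ω => ∑ i, 2 * (((fun t => S ω t i) ⬝ᵥ A *ᵥ (S ω *ᵥ w' i)) ^ 2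
      + w i ^ 2 * (κ * (T * ∑ t, S ω t i ^ 4))),
    integrable_finsetSum _ fun i _ => hint i, fun ω => ?_, ?_⟩
  · rw [l2Norm_sq, dotProduct]
    refine Finset.sum_le_sum fun i _ => ?_
    set x : Fin T → ℝ := fun t => S ω t i with hx
    have hsplit : w = w' i + w i • Pi.single i 1 := by
      ext j
      by_cases hj : j = i
      · subst hj; simp [w']
      · simp [w', hj]
    have hcol : S ω *ᵥ w = S ω *ᵥ w' i + w i • x := by
      conv_lhs => rw [hsplit, Matrix.mulVec_add, Matrix.mulVec_smul, Matrix.mulVec_single_one]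
      rfl
    have hentry : ((S ω)ᵀ *ᵥ A *ᵥ S ω *ᵥ w) i
        = x ⬝ᵥ A *ᵥ (S ω *ᵥ w' i) + w i * (x ⬝ᵥ A *ᵥ x) := by
      change x ⬝ᵥ A *ᵥ S ω *ᵥ w = _
      rw [hcol, Matrix.mulVec_add, dotProduct_add, Matrix.mulVec_smul, dotProduct_smul,
        smul_eq_mul]
    rw [hentry, ← sq]
    have h4 := mul_le_mul_of_nonneg_left (diag_sq_le hκ hA x) (sq_nonneg (w i))
    refine (add_sq_le).trans ?_
    rw [mul_pow]
    linarith
  · rw [integral_finsetSum _ fun i _ => hint i]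
    have hwle : ∀ i, l2Norm (w' i) ^ 2 ≤ l2Norm w ^ 2 := by
      intro i
      rw [l2Norm_sq, l2Norm_sq]
      refine Finset.sum_le_sum fun j _ => ?_
      by_cases hj : j = i
      · subst hj; simp [w', mul_self_nonneg]
      · simp [w', hj]
    have hterm : ∀ i, ∫ ω, 2 * (((fun t => S ω t i) ⬝ᵥ A *ᵥ (S ω *ᵥ w' i)) ^ 2
        + w i ^ 2 * (κ * (T * ∑ t, S ω t i ^ 4))) ∂μ
        ≤ 2 * (κ * (T * l2Norm w ^ 2) + w i ^ 2 * (κ * (T * (T * M)))) := by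
      intro i
      have h4 : ∑ t, ∫ ω, S ω t i ^ 4 ∂μ ≤ T * M := by
        refine (Finset.sum_le_sum fun t _ => h.fourth t i).trans ?_
        simp
      rw [integral_const_mul, integral_add (hoff i).1 (hint4 i), integral_const_mul,
        integral_const_mul, integral_const_mul,
        integral_finsetSum _ fun t _ => h.integrable_pow_four t i]
      have h5 := (hoff i).2
      have h6 : κ * (T * l2Norm (w' i) ^ 2) ≤ κ * (T * l2Norm w ^ 2) :=
        mul_le_mul_of_nonneg_left (mul_le_mul_of_nonneg_left (hwle i) (Nat.cast_nonneg _)) hκ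
      have h7 : w i ^ 2 * (κ * (T * ∑ t, ∫ ω, S ω t i ^ 4 ∂μ))
          ≤ w i ^ 2 * (κ * (T * (T * M))) := by gcongr
      linarith
    refine (Finset.sum_le_sum fun i _ => hterm i).trans (le_of_eq ?_)
    have hsum : ∑ i, w i ^ 2 = l2Norm w ^ 2 := by
      rw [l2Norm_sq]; simp [dotProduct, sq]
    rw [← Finset.mul_sum, Finset.sum_add_distrib, Finset.sum_const, ← Finset.sum_mul, hsum,
      Finset.card_univ, Fintype.card_fin, nsmul_eq_mul]
    ring

/-- An integrable bound for `‖SᵀASW‖²`. -/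
lemma exists_bound_gram_mul (h : IsNoise μ S M) {A : Matrix (Fin T) (Fin T) ℝ} {κ : ℝ}
    (hκ : 0 ≤ κ) (hA : ∀ x, l2Norm (A *ᵥ x) ^ 2 ≤ κ * l2Norm x ^ 2) {q : ℕ}
    (W : Matrix (Fin N) (Fin q) ℝ) :
    ∃ G : Ω → ℝ, Integrable G μ ∧ (∀ ω, ‖(S ω)ᵀ * (A * (S ω * W))‖ ^ 2 ≤ G ω) ∧
      ∫ ω, G ω ∂μ ≤ 2 * κ * (N * T + T ^ 2 * M) * ‖W‖ ^ 2 := by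
  choose G hG hle hintG using fun l => h.exists_bound_gram_mulVec hκ hA fun j => W j l
  refine ⟨fun ω => ∑ l, G l ω, integrable_finsetSum _ fun l _ => hG l, fun ω => ?_, ?_⟩
  · rw [norm_sq_eq_sum_col]
    exact Finset.sum_le_sum fun l _ => hle l ω
  · rw [integral_finsetSum _ fun l _ => hG l, norm_sq_eq_sum_col, Finset.mul_sum]
    exact Finset.sum_le_sum fun l _ => hintG l

/-- The second moment of `VᵀS`, for a random matrix `V` independent of `S`. -/
lemma integral_norm_transpose_mul_sq (h : IsNoise μ S M) {q : ℕ}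
    {V : Ω → Matrix (Fin T) (Fin q) ℝ} (hV : ∀ t l, MemLp (fun ω => V ω t l) 2 μ)
    (hind : IndepFun (fun ω (p : Fin T × Fin N) => S ω p.1 p.2)
      (fun ω (p : Fin T × Fin q) => V ω p.1 p.2) μ) :
    Integrable (fun ω => ‖(V ω)ᵀ * S ω‖ ^ 2) μ ∧
      ∫ ω, ‖(V ω)ᵀ * S ω‖ ^ 2 ∂μ = N * ∫ ω, ‖V ω‖ ^ 2 ∂μ := by
  have key := fun l j => integral_sq_sum_mul (μ := μ) (a := fun t ω => V ω t l)
    (s := fun t ω => S ω t j) (fun t => hV t l) (fun t => h.memLp_two t j)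
    (hind.symm.comp (φ := fun (x : Fin T × Fin q → ℝ) t => x (t, l))
      (ψ := fun (x : Fin T × Fin N → ℝ) t => x (t, j)) (by fun_prop) (by fun_prop))
    (h.integral_col_mul j)
  have heq : (fun ω => ‖(V ω)ᵀ * S ω‖ ^ 2) = fun ω => ∑ l, ∑ j, (∑ t, V ω t l * S ω t j) ^ 2 := by
    funext ω
    rw [norm_sq_eq_sum]
    rfl
  rw [heq]
  refine ⟨integrable_finsetSum _ fun l _ => integrable_finsetSum _ fun j _ => (key l j).1, ?_⟩
  rw [integral_finsetSum _ fun l _ => integrable_finsetSum _ fun j _ => (key l j).1]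
  have hin : ∀ l, ∫ ω, ∑ j, (∑ t, V ω t l * S ω t j) ^ 2 ∂μ
      = N * ∑ t, ∫ ω, V ω t l ^ 2 ∂μ := by
    intro l
    rw [integral_finsetSum _ fun j _ => (key l j).1]
    simp [(key l _).2]
  simp only [hin, norm_sq_eq_sum]
  rw [← Finset.mul_sum, Finset.sum_comm,
    integral_finsetSum _ fun t _ => integrable_finsetSum _ fun l _ => (hV t l).integrable_sq]
  simp_rw [integral_finsetSum _ fun l _ => (hV _ l).integrable_sq]

end IsNoise

end Moments

/-! ### Stochastic bounds for the error matrix -/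

section Error

open scoped Matrix.Norms.Frobenius

variable {Ω : Type*} [MeasurableSpace Ω] {μ : Measure Ω} [IsProbabilityMeasure μ]
  {T N : ℕ} {S : Ω → Matrix (Fin T) (Fin N) ℝ} {M c : ℝ}
  {P₁ : Matrix (Fin T) (Fin T) ℝ} {P₂ : Matrix (Fin N) (Fin N) ℝ}

lemma norm_mul_sq_le_of_mulVec {m k l : ℕ} {P : Matrix (Fin k) (Fin m) ℝ} (hc : 0 ≤ c)
    (h : ∀ x, l2Norm (P *ᵥ x) ^ 2 ≤ c * l2Norm x ^ 2) (A : Matrix (Fin l) (Fin k) ℝ) :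
    ‖A * P‖ ^ 2 ≤ c * ‖A‖ ^ 2 := by
  rw [← Matrix.frobenius_norm_transpose, Matrix.transpose_mul,
    ← Matrix.frobenius_norm_transpose A]
  exact norm_mul_le_of_mulVec _ (l2Norm_transpose_mulVec_sq_le hc h) _

lemma measure_norm_error_gt_le (h : IsNoise μ S M) (hc : 0 ≤ c)
    (h₁ : ∀ x, l2Norm (P₁ *ᵥ x) ^ 2 ≤ c * l2Norm x ^ 2)
    (h₂ : ∀ x, l2Norm (P₂ *ᵥ x) ^ 2 ≤ c * l2Norm x ^ 2) {k η : ℝ} (hk : 0 < k)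
    (hK : c ^ 2 * (T * N) ≤ η * k) :
    μ {ω | k < ‖P₁ * S ω * P₂‖ ^ 2} ≤ ENNReal.ofReal η := by
  refine measure_gt_le_of_integral_le (g := fun ω => c ^ 2 * ‖S ω‖ ^ 2)
    (Eventually.of_forall fun ω => ?_) (fun ω => by positivity)
    (h.integrable_norm_sq.const_mul _) hk ?_
  · refine (norm_mul_sq_le_of_mulVec hc h₂ _).trans ?_
    rw [sq c, mul_assoc]
    exact mul_le_mul_of_nonneg_left (norm_mul_le_of_mulVec _ h₁ _) hc
  · rwa [integral_const_mul, h.integral_norm_sq]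

/-- `P₁ᵀF` is still independent of `S`, so conditioning is replaced by the second-moment identity
for `VᵀS` with `V = P₁ᵀF`; the factor `P₂` costs its operator norm. -/
lemma measure_norm_error_transpose_mul_gt_le (h : IsNoise μ S M) (hc : 0 ≤ c)
    (h₁ : ∀ x, l2Norm (P₁ *ᵥ x) ^ 2 ≤ c * l2Norm x ^ 2)
    (h₂ : ∀ x, l2Norm (P₂ *ᵥ x) ^ 2 ≤ c * l2Norm x ^ 2) {r : ℕ}
    {F : Ω → Matrix (Fin T) (Fin r) ℝ} (hF : ∀ t l, MemLp (fun ω => F ω t l) 2 μ)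
    (hF1 : ∀ t l, ∫ ω, F ω t l ^ 2 ∂μ = 1)
    (hind : IndepFun (fun ω (p : Fin T × Fin N) => S ω p.1 p.2)
      (fun ω (p : Fin T × Fin r) => F ω p.1 p.2) μ) {k η : ℝ} (hk : 0 < k)
    (hK : c ^ 2 * (N * (T * r)) ≤ η * k) :
    μ {ω | k < ‖(P₁ * S ω * P₂)ᵀ * F ω‖ ^ 2} ≤ ENNReal.ofReal η := by
  have hV : ∀ t l, MemLp (fun ω => (P₁ᵀ * F ω) t l) 2 μ := fun t l => by
    simp only [Matrix.mul_apply]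
    exact memLp_finsetSum _ fun u _ => (hF u l).const_mul _
  have hindV : IndepFun (fun ω (p : Fin T × Fin N) => S ω p.1 p.2)
      (fun ω (p : Fin T × Fin r) => (P₁ᵀ * F ω) p.1 p.2) μ :=
    hind.comp (φ := id)
      (ψ := fun (x : Fin T × Fin r → ℝ) (p : Fin T × Fin r) => ∑ u, P₁ᵀ p.1 u * x (u, p.2))
      measurable_id (by fun_prop)
  have hmain := h.integral_norm_transpose_mul_sq hV hindV
  have hFint : Integrable (fun ω => ‖F ω‖ ^ 2) μ := by
    simp only [norm_sq_eq_sum]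
    exact integrable_finsetSum _ fun t _ => integrable_finsetSum _ fun l _ =>
      (hF t l).integrable_sq
  have hFval : ∫ ω, ‖F ω‖ ^ 2 ∂μ = T * r := by
    simp only [norm_sq_eq_sum]
    rw [integral_finsetSum _ fun t _ => integrable_finsetSum _ fun l _ => (hF t l).integrable_sq]
    simp_rw [integral_finsetSum _ fun l _ => (hF _ l).integrable_sq, hF1]
    simp
  have hVle : ∫ ω, ‖P₁ᵀ * F ω‖ ^ 2 ∂μ ≤ c * (T * r) := by
    rw [← hFval, ← integral_const_mul]
    refine integral_mono ?_ (hFint.const_mul c) fun ω =>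
      norm_mul_le_of_mulVec _ (l2Norm_transpose_mulVec_sq_le hc h₁) _
    simp only [norm_sq_eq_sum]
    exact integrable_finsetSum _ fun t _ => integrable_finsetSum _ fun l _ =>
      (hV t l).integrable_sq
  refine measure_gt_le_of_integral_le (g := fun ω => c * ‖(P₁ᵀ * F ω)ᵀ * S ω‖ ^ 2)
    (Eventually.of_forall fun ω => ?_) (fun ω => by positivity) (hmain.1.const_mul _) hk ?_
  · have heq : (P₁ * S ω * P₂)ᵀ * F ω = ((P₁ᵀ * F ω)ᵀ * S ω * P₂)ᵀ := by
      simp only [Matrix.transpose_mul, Matrix.transpose_transpose, Matrix.mul_assoc]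
    rw [heq, Matrix.frobenius_norm_transpose]
    exact norm_mul_sq_le_of_mulVec hc h₂ _
  · rw [integral_const_mul, hmain.2]
    refine le_trans ?_ hK
    calc c * (N * ∫ ω, ‖P₁ᵀ * F ω‖ ^ 2 ∂μ) ≤ c * (N * (c * (T * r))) := by gcongr
      _ = _ := by ring

/-- Applied later with `W = 1` and `W = D⁻¹B`. Both have `‖W‖² ≲ N`, so that `‖EᵀEW‖` is of order
`√N T` when `N ≤ T`. -/
lemma measure_norm_error_gram_mul_gt_le (h : IsNoise μ S M) (hc : 0 ≤ c) (hM : 0 ≤ M)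
    (h₁ : ∀ x, l2Norm (P₁ *ᵥ x) ^ 2 ≤ c * l2Norm x ^ 2)
    (h₂ : ∀ x, l2Norm (P₂ *ᵥ x) ^ 2 ≤ c * l2Norm x ^ 2) {q : ℕ}
    (W : Matrix (Fin N) (Fin q) ℝ) {k η : ℝ} (hk : 0 < k)
    (hK : 2 * c ^ 4 * (N * T + T ^ 2 * M) * ‖W‖ ^ 2 ≤ η * k) :
    μ {ω | k < ‖(P₁ * S ω * P₂)ᵀ * (P₁ * S ω * P₂) * W‖ ^ 2} ≤ ENNReal.ofReal η := by
  have hA : ∀ x, l2Norm ((P₁ᵀ * P₁) *ᵥ x) ^ 2 ≤ c ^ 2 * l2Norm x ^ 2 := by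
    intro x
    rw [← Matrix.mulVec_mulVec, sq c, mul_assoc]
    exact (l2Norm_transpose_mulVec_sq_le hc h₁ _).trans (mul_le_mul_of_nonneg_left (h₁ x) hc)
  obtain ⟨G, hG, hle, hint⟩ := h.exists_bound_gram_mul (sq_nonneg c) hA (P₂ * W)
  have hG0 : ∀ ω, 0 ≤ G ω := fun ω => (sq_nonneg _).trans (hle ω)
  refine measure_gt_le_of_integral_le (g := fun ω => c * G ω)
    (Eventually.of_forall fun ω => ?_) (fun ω => mul_nonneg hc (hG0 ω)) (hG.const_mul _) hk ?_
  · have heq : (P₁ * S ω * P₂)ᵀ * (P₁ * S ω * P₂) * W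
        = P₂ᵀ * ((S ω)ᵀ * (P₁ᵀ * P₁ * (S ω * (P₂ * W)))) := by
      simp only [Matrix.transpose_mul, Matrix.mul_assoc]
    rw [heq]
    exact (norm_mul_le_of_mulVec _ (l2Norm_transpose_mulVec_sq_le hc h₂) _).trans
      (mul_le_mul_of_nonneg_left (hle ω) hc)
  · rw [integral_const_mul]
    refine le_trans ?_ hK
    have hW := norm_mul_le_of_mulVec _ h₂ W
    calc c * ∫ ω, G ω ∂μ
        ≤ c * (2 * c ^ 2 * (N * T + T ^ 2 * M) * (c * ‖W‖ ^ 2)) := by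
          refine mul_le_mul_of_nonneg_left (hint.trans ?_) hc
          gcongr
      _ = _ := by ring

end Error

/-! ### Perturbation bounds for the penalized PCA estimators -/

section Perturbation

open scoped Matrix.Norms.Frobenius

variable {N T r : ℕ} {lam c k s τ : ℝ} {B : Matrix (Fin N) (Fin r) ℝ}
  {F Fhat : Matrix (Fin T) (Fin r) ℝ} {E : Matrix (Fin T) (Fin N) ℝ}

lemma gram_isHermitian (hlam : 0 ≤ lam) (X : Matrix (Fin T) (Fin N) ℝ) :
    (gram lam X).IsHermitian := by
  rw [Matrix.IsHermitian, Matrix.conjTranspose_eq_transpose_of_trivial, gram]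
  simp only [Matrix.transpose_mul, Matrix.transpose_transpose, penaltyMatrix_inv_transpose N hlam,
    Matrix.mul_assoc]

lemma l2Norm_mulVec_sq_of_orthogonal (hF : Fᵀ * F = (T : ℝ) • 1) (u : Fin r → ℝ) :
    l2Norm (F *ᵥ u) ^ 2 = T * l2Norm u ^ 2 := by
  rw [l2Norm_sq, Matrix.dotProduct_mulVec, ← Matrix.mulVec_transpose, Matrix.mulVec_mulVec, hF,
    Matrix.smul_mulVec, Matrix.one_mulVec, smul_dotProduct, ← l2Norm_sq, smul_eq_mul]

lemma norm_sq_of_orthogonal (hF : Fᵀ * F = (T : ℝ) • 1) : ‖F‖ ^ 2 = T * r := by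
  rw [norm_sq_eq_trace, hF, Matrix.trace_smul, Matrix.trace_one, Fintype.card_fin, smul_eq_mul]

lemma l2Norm_eq_zero {m : ℕ} {u : Fin m → ℝ} (h : l2Norm u = 0) : u = 0 := by
  simpa [l2Norm] using h

/-- Of the signal `3cNT²‖u‖²`, the penalty and the cross term with the errors each consume at most
`cNT²‖u‖²`; the remaining third is the lower bound, since `‖Fu‖² = T‖u‖²`. -/
lemma le_dotProduct_gram (hlam : 0 ≤ lam) (hF : Fᵀ * F = (T : ℝ) • 1)
    (hB : ∀ u, 3 * c * N * l2Norm u ^ 2 ≤ l2Norm (B *ᵥ u) ^ 2)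
    (hstar : lam * bStarSq B ≤ c * N) (hEF : 2 * (‖B‖ * ‖Eᵀ * F‖) ≤ c * N * T) (u : Fin r → ℝ) :
    c * (N * T) * l2Norm (F *ᵥ u) ^ 2
      ≤ (F *ᵥ u) ⬝ᵥ gram lam (F * Bᵀ + E) *ᵥ (F *ᵥ u) := by
  set D := (penaltyMatrix N lam)⁻¹ with hD
  have hT : (0 : ℝ) ≤ T := Nat.cast_nonneg T
  have hX : (F * Bᵀ + E)ᵀ *ᵥ (F *ᵥ u) = (T : ℝ) • (B *ᵥ u) + (Eᵀ * F) *ᵥ u := by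
    rw [Matrix.mulVec_mulVec, Matrix.transpose_add, Matrix.transpose_mul,
      Matrix.transpose_transpose, Matrix.add_mul, Matrix.mul_assoc, hF, Matrix.add_mulVec,
      Matrix.mul_smul, Matrix.mul_one, Matrix.smul_mulVec]
  have hq : (F *ᵥ u) ⬝ᵥ gram lam (F * Bᵀ + E) *ᵥ (F *ᵥ u)
      = ((T : ℝ) • (B *ᵥ u) + (Eᵀ * F) *ᵥ u) ⬝ᵥ D *ᵥ ((T : ℝ) • (B *ᵥ u) + (Eᵀ * F) *ᵥ u) := by
    rw [← hX, gram, ← Matrix.mulVec_mulVec, ← Matrix.mulVec_mulVec, Matrix.dotProduct_mulVec,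
      ← Matrix.mulVec_transpose]
  rw [hq, l2Norm_mulVec_sq_of_orthogonal hF]
  refine le_trans ?_ (dotProduct_penaltyMatrix_inv_add_ge hlam _ _)
  rw [Matrix.mulVec_smul, l2Norm_smul, l2Norm_smul, abs_of_nonneg hT, Matrix.mulVec_mulVec]
  have h1 := hB u
  have h2 : l2Norm ((laplacian N * B) *ᵥ u) ^ 2 ≤ bStarSq B * l2Norm u ^ 2 := by
    rw [bStarSq, frobNorm_eq_norm, ← mul_pow]
    exact pow_le_pow_left₀ (l2Norm_nonneg _) (l2Norm_mulVec_le _ _) 2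
  have h3 : lam * l2Norm ((laplacian N * B) *ᵥ u) ^ 2 ≤ c * N * l2Norm u ^ 2 := by
    calc _ ≤ lam * (bStarSq B * l2Norm u ^ 2) := by gcongr
      _ = lam * bStarSq B * l2Norm u ^ 2 := by ring
      _ ≤ _ := by gcongr
  have h4 : 2 * (l2Norm (B *ᵥ u) * l2Norm ((Eᵀ * F) *ᵥ u)) ≤ c * N * T * l2Norm u ^ 2 := by
    calc _ ≤ 2 * ((‖B‖ * l2Norm u) * (‖Eᵀ * F‖ * l2Norm u)) := by
          have := l2Norm_nonneg (B *ᵥ u)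
          have := l2Norm_nonneg ((Eᵀ * F) *ᵥ u)
          have := l2Norm_nonneg u
          gcongr
          · exact l2Norm_mulVec_le _ _
          · exact l2Norm_mulVec_le _ _
      _ = 2 * (‖B‖ * ‖Eᵀ * F‖) * l2Norm u ^ 2 := by ring
      _ ≤ _ := by gcongr
  have h5 := mul_le_mul_of_nonneg_left h1 (sq_nonneg (T : ℝ))
  have h6 := mul_le_mul_of_nonneg_left h3 (sq_nonneg (T : ℝ))
  have h7 := mul_le_mul_of_nonneg_left h4 hT
  nlinarith

lemma injective_of_orthogonal (hT : 0 < T) (hF : Fᵀ * F = (T : ℝ) • 1) (u : Fin r → ℝ)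
    (hu : F *ᵥ u = 0) : u = 0 := by
  have h1 := l2Norm_mulVec_sq_of_orthogonal hF u
  have hT' : (T : ℝ) ≠ 0 := by positivity
  rw [hu] at h1
  have h0 : l2Norm (0 : Fin T → ℝ) = 0 := by simp [l2Norm]
  rw [h0, zero_pow two_ne_zero, eq_comm, mul_eq_zero] at h1
  exact l2Norm_eq_zero (by simpa [hT'] using h1)

/-- Guarantees `r ≤ T`, so that the `r` leading values of `eigDesc` are true eigenvalues and not its
default `0`. -/
lemma lt_of_orthogonal (hT : 0 < T) (hF : Fᵀ * F = (T : ℝ) • 1) {l : ℕ} (hl : l < r) : l < T := by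
  refine lt_of_lt_of_le hl ?_
  by_contra hlt
  have hker : LinearMap.ker F.mulVecLin ≠ ⊥ :=
    LinearMap.ker_ne_bot_of_finrank_lt (by simpa using hlt)
  obtain ⟨u, hu, hu0⟩ := Submodule.exists_mem_ne_zero_of_ne_bot hker
  exact hu0 (injective_of_orthogonal hT hF u hu)

/-- The bounds under which the `r` largest eigenvalues of the Gram matrix are of order `NT`. -/
structure SignalBounds (lam c : ℝ) (B : Matrix (Fin N) (Fin r) ℝ) (F : Matrix (Fin T) (Fin r) ℝ)
    (E : Matrix (Fin T) (Fin N) ℝ) : Prop where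
  lam_nonneg : 0 ≤ lam
  N_pos : 0 < N
  T_pos : 0 < T
  c_pos : 0 < c
  orthogonal : Fᵀ * F = (T : ℝ) • 1
  loading : ∀ u, 3 * c * N * l2Norm u ^ 2 ≤ l2Norm (B *ᵥ u) ^ 2
  penalty : lam * bStarSq B ≤ c * N
  error : 2 * (‖B‖ * ‖Eᵀ * F‖) ≤ c * N * T

namespace SignalBounds

lemma le_eigDesc_gram (h : SignalBounds lam c B F E) {l : ℕ} (hl : l < r) :
    c * (N * T) ≤ eigDesc (gram lam (F * Bᵀ + E)) l :=
  le_eigDesc (gram_isHermitian h.lam_nonneg _) F (injective_of_orthogonal h.T_pos h.orthogonal)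
    (le_dotProduct_gram h.lam_nonneg h.orthogonal h.loading h.penalty h.error) hl
    (lt_of_orthogonal h.T_pos h.orthogonal hl)

lemma le_eigDesc_smul_gram (h : SignalBounds lam c B F E) {l : ℕ} (hl : l < r) :
    c ≤ eigDesc ((1 / ((N : ℝ) * (T : ℝ))) • gram lam (F * Bᵀ + E)) l := by
  have hNT : 0 < (N : ℝ) * T := by
    have := h.N_pos; have := h.T_pos; positivity
  refine le_eigDesc ?_ F (injective_of_orthogonal h.T_pos h.orthogonal) (fun u => ?_) hl
    (lt_of_orthogonal h.T_pos h.orthogonal hl)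
  · have := gram_isHermitian h.lam_nonneg (F * Bᵀ + E)
    rw [Matrix.IsHermitian, Matrix.conjTranspose_eq_transpose_of_trivial] at this ⊢
    rw [Matrix.transpose_smul, this]
  · have := le_dotProduct_gram h.lam_nonneg h.orthogonal h.loading h.penalty h.error u
    rw [Matrix.smul_mulVec, dotProduct_smul, smul_eq_mul, one_div, inv_mul_eq_div,
      le_div_iff₀ hNT]
    linarith

lemma norm_rotation_le (h : SignalBounds lam c B F E) (hFhat : Fhatᵀ * Fhat = (T : ℝ) • 1)
    {β : ℝ} (hB : ‖B‖ ^ 2 ≤ β * N) :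
    ‖rotation lam B F (F * Bᵀ + E) Fhat‖ ≤ β * r * (Real.sqrt r / c) := by
  have hN : 0 < (N : ℝ) := Nat.cast_pos.mpr h.N_pos
  have hT : 0 < (T : ℝ) := Nat.cast_pos.mpr h.T_pos
  have hβ : 0 ≤ β := nonneg_of_mul_nonneg_left ((sq_nonneg ‖B‖).trans hB) hN
  set Δ : Fin r → ℝ := fun l => eigDesc ((1 / ((N : ℝ) * (T : ℝ))) • gram lam (F * Bᵀ + E)) l
    with hΔ
  have hΔc : ∀ l, c ≤ Δ l := fun l => h.le_eigDesc_smul_gram l.2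
  have h1 : ‖(1 / (N : ℝ)) • (Bᵀ * (penaltyMatrix N lam)⁻¹ * B)‖ ≤ β := by
    rw [norm_smul, Real.norm_of_nonneg (by positivity), one_div, inv_mul_eq_div, div_le_iff₀ hN]
    refine le_trans ?_ hB
    calc _ ≤ ‖Bᵀ * (penaltyMatrix N lam)⁻¹‖ * ‖B‖ := Matrix.frobenius_norm_mul _ _
      _ ≤ ‖Bᵀ‖ * ‖B‖ := by gcongr; exact norm_mul_penaltyMatrix_inv_le h.lam_nonneg _
      _ = _ := by rw [Matrix.frobenius_norm_transpose, sq]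
  have h2 : ‖(1 / (T : ℝ)) • (Fᵀ * Fhat)‖ ≤ r := by
    rw [norm_smul, Real.norm_of_nonneg (by positivity), one_div, inv_mul_eq_div, div_le_iff₀ hT]
    have ha := norm_sq_of_orthogonal h.orthogonal
    have hb := norm_sq_of_orthogonal hFhat
    have hm := Matrix.frobenius_norm_mul Fᵀ Fhat
    rw [Matrix.frobenius_norm_transpose] at hm
    nlinarith [sq_nonneg (‖F‖ - ‖Fhat‖)]
  have h3 : ‖(Matrix.diagonal Δ)⁻¹‖ ≤ Real.sqrt r / c := by
    have hdet : IsUnit (Matrix.diagonal Δ).det := by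
      rw [Matrix.det_diagonal]
      exact (Finset.prod_ne_zero_iff.mpr fun l _ => (h.c_pos.trans_le (hΔc l)).ne').isUnit
    have hm := norm_mul_diagonal_ge (Matrix.diagonal Δ)⁻¹ Δ h.c_pos.le hΔc
    rw [Matrix.nonsing_inv_mul _ hdet] at hm
    have h1 : ‖(1 : Matrix (Fin r) (Fin r) ℝ)‖ = Real.sqrt r := by
      rw [← Real.sqrt_sq (norm_nonneg (1 : Matrix (Fin r) (Fin r) ℝ)), norm_sq_eq_trace]
      simp
    rw [le_div_iff₀ h.c_pos, ← h1]
    linarith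
  rw [rotation]
  refine (Matrix.frobenius_norm_mul _ _).trans ?_
  refine mul_le_mul ((Matrix.frobenius_norm_mul _ _).trans ?_) h3 (norm_nonneg _) (by positivity)
  exact mul_le_mul h1 h2 (norm_nonneg _) hβ

end SignalBounds

/-- Used in two directions: a bound on `H` makes `d_n` bounded above, and it turns a lower bound for
`d_n` into one for `‖b_i - b_j‖`. -/
lemma minSignal_le {K : ℕ} (g : Fin N → Fin K) (H : Matrix (Fin r) (Fin r) ℝ) {i j : Fin N}
    (hij : g i ≠ g j) : minSignal g B H ≤ ‖H‖ * l2Norm (B i - B j) := by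
  have h1 : minSignal g B H ≤ l2Norm (Hᵀ *ᵥ (B i - B j)) := by
    refine csInf_le ⟨0, ?_⟩ ⟨i, j, hij, rfl⟩
    rintro _ ⟨a, b, -, rfl⟩
    exact l2Norm_nonneg _
  refine h1.trans ((l2Norm_mulVec_le _ _).trans ?_)
  rw [Matrix.frobenius_norm_transpose]

/-- The bounds under which the estimated loadings separate the groups; `s` and `τ` stand for
`√N` and `√T`. -/
structure NoiseBounds (lam c k s τ : ℝ) (B : Matrix (Fin N) (Fin r) ℝ)
    (F : Matrix (Fin T) (Fin r) ℝ) (E : Matrix (Fin T) (Fin N) ℝ) : Prop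
    extends SignalBounds lam c B F E where
  one_le : 1 ≤ k
  s_pos : 0 < s
  s_sq : s ^ 2 = N
  τ_pos : 0 < τ
  τ_sq : τ ^ 2 = T
  sqrt_le : Real.sqrt r ≤ k
  norm_loading : ‖B‖ ≤ k * s
  norm_error : ‖E‖ ≤ k * (s * τ)
  norm_error_factor : ‖Eᵀ * F‖ ≤ k * (s * τ)
  norm_error_gram : ‖Eᵀ * E‖ ≤ k * (s * τ ^ 2)
  norm_error_gram_loading : ‖Eᵀ * E * ((penaltyMatrix N lam)⁻¹ * B)‖ ≤ k * (s * τ ^ 2)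

lemma norm_mul_le_mul {a b d : ℕ} {P : Matrix (Fin a) (Fin b) ℝ} {Q : Matrix (Fin b) (Fin d) ℝ}
    {p q : ℝ} (hP : ‖P‖ ≤ p) (hQ : ‖Q‖ ≤ q) : ‖P * Q‖ ≤ p * q :=
  (Matrix.frobenius_norm_mul P Q).trans
    (mul_le_mul hP hQ (norm_nonneg _) ((norm_nonneg _).trans hP))

namespace NoiseBounds

lemma norm_orthogonal_le (h : NoiseBounds lam c k s τ B F E) {G : Matrix (Fin T) (Fin r) ℝ}
    (hG : Gᵀ * G = (T : ℝ) • 1) : ‖G‖ ≤ k * τ := by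
  have hk := h.one_le
  have hτ := h.τ_pos
  refine abs_le_of_sq_le_sq' ?_ (by positivity) |>.2
  rw [norm_sq_of_orthogonal hG, mul_pow, h.τ_sq, mul_comm]
  refine mul_le_mul_of_nonneg_right ?_ (Nat.cast_nonneg T)
  rw [← Real.sq_sqrt (Nat.cast_nonneg r)]
  exact pow_le_pow_left₀ (Real.sqrt_nonneg _) h.sqrt_le 2

lemma norm_data_le (h : NoiseBounds lam c k s τ B F E) :
    ‖F * Bᵀ + E‖ ≤ 2 * k ^ 2 * (s * τ) := by
  have hk := h.one_le
  have hτ := h.τ_pos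
  have hs := h.s_pos
  have hB : ‖Bᵀ‖ ≤ k * s := by rw [Matrix.frobenius_norm_transpose]; exact h.norm_loading
  have h1 := norm_mul_le_mul (h.norm_orthogonal_le h.orthogonal) hB
  have h2 : k * (s * τ) ≤ k ^ 2 * (s * τ) := by gcongr; nlinarith
  calc _ ≤ ‖F * Bᵀ‖ + ‖E‖ := norm_add_le _ _
    _ ≤ k * τ * (k * s) + k ^ 2 * (s * τ) := add_le_add h1 (h.norm_error.trans h2)
    _ = _ := by ring

lemma norm_projected_data_le (h : NoiseBounds lam c k s τ B F E)
    (hFhat : Fhatᵀ * Fhat = (T : ℝ) • 1) :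
    ‖(penaltyMatrix N lam)⁻¹ * ((F * Bᵀ + E)ᵀ * Fhat)‖ ≤ 2 * k ^ 3 * (s * τ ^ 2) := by
  refine (norm_penaltyMatrix_inv_mul_le h.lam_nonneg _).trans ?_
  have hX : ‖(F * Bᵀ + E)ᵀ‖ ≤ 2 * k ^ 2 * (s * τ) := by
    rw [Matrix.frobenius_norm_transpose]; exact h.norm_data_le
  refine (norm_mul_le_mul hX (h.norm_orthogonal_le hFhat)).trans (le_of_eq ?_)
  ring

lemma norm_loading_projected_data_le (h : NoiseBounds lam c k s τ B F E)
    (hFhat : Fhatᵀ * Fhat = (T : ℝ) • 1) :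
    ‖Bᵀ * ((penaltyMatrix N lam)⁻¹ * ((F * Bᵀ + E)ᵀ * Fhat))‖
      ≤ 2 * k ^ 4 * (s ^ 2 * τ ^ 2) := by
  have hB : ‖Bᵀ‖ ≤ k * s := by rw [Matrix.frobenius_norm_transpose]; exact h.norm_loading
  refine (norm_mul_le_mul hB (h.norm_projected_data_le hFhat)).trans (le_of_eq ?_)
  ring

/-- The eigenvalue equation bounds the projection of the errors on the estimated factors. -/
lemma norm_error_estimator_le (h : NoiseBounds lam c k s τ B F E)
    (hFhat : IsFactorEstimator lam (F * Bᵀ + E) Fhat) (hlarge : 2 * k ≤ c * s) {m : ℝ}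
    (hm1 : s ≤ m * τ) (hm2 : 1 ≤ m * s) :
    ‖Eᵀ * Fhat‖ ≤ 6 * k ^ 5 / c * m * τ ^ 2 := by
  have hk := h.one_le
  have hτ := h.τ_pos
  have hs := h.s_pos
  have hc := h.c_pos
  have hm : 0 < m := by
    by_contra hneg
    nlinarith
  set D := (penaltyMatrix N lam)⁻¹ with hD
  set V := Eᵀ * Fhat with hV
  set δ : Fin r → ℝ := fun l => eigDesc (gram lam (F * Bᵀ + E)) l with hδ
  have hδc : ∀ l, c * (s ^ 2 * τ ^ 2) ≤ δ l := fun l => by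
    rw [h.s_sq, h.τ_sq]; exact h.le_eigDesc_gram l.2
  -- The eigenvalue equation multiplied by `Eᵀ`, with `X = FBᵀ + E` expanded in both places. The
  -- unknown `V` recurs on the right with the coefficient `EᵀE D⁻¹`.
  have heq : V * Matrix.diagonal δ = Eᵀ * F * (Bᵀ * (D * ((F * Bᵀ + E)ᵀ * Fhat)))
      + (Eᵀ * E * (D * B) * (Fᵀ * Fhat) + Eᵀ * E * (D * V)) := by
    rw [hV, Matrix.mul_assoc, ← hFhat.2, gram, ← hD]
    simp only [Matrix.transpose_add, Matrix.transpose_mul, Matrix.transpose_transpose,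
      Matrix.add_mul, Matrix.mul_add, Matrix.mul_assoc]
    abel
  have h1 := norm_mul_diagonal_ge V δ (by positivity) hδc
  have h2 := norm_mul_le_mul h.norm_error_factor (h.norm_loading_projected_data_le hFhat.1)
  have h3 : ‖Fᵀ * Fhat‖ ≤ k * τ * (k * τ) := by
    refine norm_mul_le_mul ?_ (h.norm_orthogonal_le hFhat.1)
    rw [Matrix.frobenius_norm_transpose]
    exact h.norm_orthogonal_le h.orthogonal
  have h4 := norm_mul_le_mul h.norm_error_gram_loading h3
  have h5 := norm_mul_le_mul h.norm_error_gram (norm_penaltyMatrix_inv_mul_le h.lam_nonneg V)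
  have h6 : c * (s ^ 2 * τ ^ 2) * ‖V‖ ≤ k * (s * τ) * (2 * k ^ 4 * (s ^ 2 * τ ^ 2))
      + (k * (s * τ ^ 2) * (k * τ * (k * τ)) + k * (s * τ ^ 2) * ‖V‖) := by
    refine h1.trans ?_
    rw [heq]
    exact (norm_add_le _ _).trans (add_le_add h2 ((norm_add_le _ _).trans (add_le_add h4 h5)))
  -- For large `N` the recurring term is at most half of the left-hand side. The other two are
  -- converted to the rate `m` by `1 ≤ m s` and `s ≤ m τ`.
  have h7 : k * (s * τ ^ 2) * ‖V‖ ≤ c / 2 * (s ^ 2 * τ ^ 2) * ‖V‖ := by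
    refine mul_le_mul_of_nonneg_right ?_ (norm_nonneg _)
    nlinarith [mul_le_mul_of_nonneg_right hlarge (by positivity : 0 ≤ s * τ ^ 2)]
  have h8 : k ^ 3 * (s * τ ^ 4) ≤ k ^ 5 * (m * (s ^ 2 * τ ^ 4)) := by
    have ha : k ^ 3 ≤ k ^ 5 := pow_le_pow_right₀ hk (by norm_num)
    have hb : s * τ ^ 4 ≤ m * (s ^ 2 * τ ^ 4) := by
      nlinarith [mul_le_mul_of_nonneg_right hm2 (by positivity : 0 ≤ s * τ ^ 4)]
    exact mul_le_mul ha hb (by positivity) (by positivity)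
  have h9 : 2 * k ^ 5 * (s ^ 3 * τ ^ 3) ≤ 2 * k ^ 5 * (m * (s ^ 2 * τ ^ 4)) := by
    refine mul_le_mul_of_nonneg_left ?_ (by positivity)
    nlinarith [mul_le_mul_of_nonneg_right hm1 (by positivity : 0 ≤ s ^ 2 * τ ^ 3)]
  have h10 : s ^ 2 * τ ^ 2 * (c / 2 * ‖V‖) ≤ s ^ 2 * τ ^ 2 * (3 * k ^ 5 * m * τ ^ 2) := by
    linear_combination h6 + h7 + h8 + h9
  have h11 := le_of_mul_le_mul_left h10 (by positivity)
  rw [show 6 * k ^ 5 / c * m * τ ^ 2 = 6 * k ^ 5 * m * τ ^ 2 / c by ring, le_div_iff₀ hc]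
  linarith

/-- The cross product of the estimated and the true factors is well conditioned. -/
lemma l2Norm_cross_mulVec_ge (h : NoiseBounds lam c k s τ B F E)
    (hFhat : IsFactorEstimator lam (F * Bᵀ + E) Fhat) (hlarge : 2 * k ≤ c * s) {m : ℝ}
    (hm1 : s ≤ m * τ) (hm2 : 1 ≤ m * s) (hm3 : 24 * k ^ 8 * m ≤ c ^ 2 * s) (v : Fin r → ℝ) :
    c * τ ^ 2 * l2Norm v ≤ 4 * k ^ 4 * l2Norm ((Fhatᵀ * F) *ᵥ v) := by
  have hk := h.one_le
  have hτ := h.τ_pos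
  have hs := h.s_pos
  have hc := h.c_pos
  set D := (penaltyMatrix N lam)⁻¹ with hD
  set V := Eᵀ * Fhat with hV
  set W := D * ((F * Bᵀ + E)ᵀ * Fhat) with hW
  set δ : Fin r → ℝ := fun l => eigDesc (gram lam (F * Bᵀ + E)) l with hδ
  have hδc : ∀ l, c * (s ^ 2 * τ ^ 2) ≤ δ l := fun l => by
    rw [h.s_sq, h.τ_sq]; exact h.le_eigDesc_gram l.2
  -- The eigenvalue equation multiplied by `F̂ᵀ`. Its left side is at least of order `NT²`, and
  -- `VᵀW` takes away at most half of that bound.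
  have heq : (T : ℝ) • Matrix.diagonal δ = Fhatᵀ * F * (Bᵀ * W) + Vᵀ * W := by
    have h1 : Fhatᵀ * (gram lam (F * Bᵀ + E) * Fhat) = (T : ℝ) • Matrix.diagonal δ := by
      rw [hFhat.2, ← Matrix.mul_assoc, hFhat.1, Matrix.smul_mul, Matrix.one_mul]
    rw [← h1, gram, ← hD, hV]
    have h2 : (F * Bᵀ + E) * D * (F * Bᵀ + E)ᵀ * Fhat = (F * Bᵀ + E) * W := by
      simp only [hW, Matrix.mul_assoc]
    rw [h2]
    simp only [Matrix.transpose_mul, Matrix.transpose_transpose, Matrix.add_mul, Matrix.mul_add,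
      Matrix.mul_assoc]
  have hVW : ‖Vᵀ * W‖ ≤ c / 2 * (s ^ 2 * τ ^ 4) := by
    have hV' : ‖Vᵀ‖ ≤ 6 * k ^ 5 / c * m * τ ^ 2 := by
      rw [Matrix.frobenius_norm_transpose]
      exact h.norm_error_estimator_le hFhat hlarge hm1 hm2
    refine (norm_mul_le_mul hV' (h.norm_projected_data_le hFhat.1)).trans ?_
    rw [show 6 * k ^ 5 / c * m * τ ^ 2 * (2 * k ^ 3 * (s * τ ^ 2))
      = 24 * k ^ 8 * m * (s * τ ^ 4) / (2 * c) by field_simp; ring, div_le_iff₀ (by positivity)]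
    nlinarith [mul_le_mul_of_nonneg_right hm3 (by positivity : 0 ≤ s * τ ^ 4)]
  have hmain : ∀ w, c / 2 * (s ^ 2 * τ ^ 4) * l2Norm w
      ≤ l2Norm ((Fhatᵀ * F) *ᵥ ((Bᵀ * W) *ᵥ w)) := by
    intro w
    have h1 : (Fhatᵀ * F) *ᵥ ((Bᵀ * W) *ᵥ w)
        = (T : ℝ) • (Matrix.diagonal δ *ᵥ w) - (Vᵀ * W) *ᵥ w := by
      rw [← Matrix.smul_mulVec, heq, Matrix.add_mulVec, Matrix.mulVec_mulVec, add_sub_cancel_right]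
    have h2 := l2Norm_diagonal_mulVec_ge δ w (by positivity) hδc
    have h3 : l2Norm ((Vᵀ * W) *ᵥ w) ≤ c / 2 * (s ^ 2 * τ ^ 4) * l2Norm w :=
      (l2Norm_mulVec_le _ _).trans (mul_le_mul_of_nonneg_right hVW (l2Norm_nonneg w))
    have h4 : l2Norm ((T : ℝ) • (Matrix.diagonal δ *ᵥ w))
        ≤ l2Norm ((Fhatᵀ * F) *ᵥ ((Bᵀ * W) *ᵥ w)) + l2Norm ((Vᵀ * W) *ᵥ w) := by
      refine le_trans (le_of_eq ?_) (l2Norm_add_le _ _)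
      rw [h1, sub_add_cancel]
    rw [l2Norm_smul, abs_of_nonneg (Nat.cast_nonneg T), ← h.τ_sq] at h4
    have h5 := mul_le_mul_of_nonneg_left h2 (sq_nonneg τ)
    nlinarith
  -- The square matrix `BᵀW` is injective, hence onto, so every `v` is of the form `BᵀW w`; its norm
  -- bound `2k⁴NT` then transfers the estimate from `w` to `v`.
  have hinj : Function.Injective (Bᵀ * W).mulVecLin := by
    rw [← LinearMap.ker_eq_bot, LinearMap.ker_eq_bot']
    intro w hw
    have h1 := hmain w
    rw [Matrix.mulVecLin_apply] at hw
    have h0 : l2Norm (0 : Fin r → ℝ) = 0 := by simp [l2Norm]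
    rw [hw, Matrix.mulVec_zero, h0] at h1
    have h2 : 0 < c / 2 * (s ^ 2 * τ ^ 4) := by positivity
    exact l2Norm_eq_zero (le_antisymm (nonpos_of_mul_nonpos_right h1 h2) (l2Norm_nonneg w))
  obtain ⟨w, rfl⟩ := LinearMap.injective_iff_surjective.mp hinj v
  rw [Matrix.mulVecLin_apply]
  have h1 := hmain w
  have h2 : l2Norm ((Bᵀ * W) *ᵥ w) ≤ 2 * k ^ 4 * (s ^ 2 * τ ^ 2) * l2Norm w :=
    (l2Norm_mulVec_le _ _).trans (mul_le_mul_of_nonneg_right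
      (h.norm_loading_projected_data_le hFhat.1) (l2Norm_nonneg w))
  have h3 := mul_le_mul_of_nonneg_left h2 (by positivity : 0 ≤ c * τ ^ 2)
  have h4 := mul_le_mul_of_nonneg_left h1 (by positivity : 0 ≤ 4 * k ^ 4)
  linarith

end NoiseBounds

lemma loadingEstimator_row_sub (hlam : 0 ≤ lam) (i j : Fin N) :
    loadingEstimator lam (F * Bᵀ + E) Fhat i - loadingEstimator lam (F * Bᵀ + E) Fhat j
      = (1 / (T : ℝ) * (1 / (1 + lam))) •
        ((Fhatᵀ * F) *ᵥ (B i - B j) + ((Eᵀ * Fhat) i - (Eᵀ * Fhat) j)) := by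
  have h1 := penaltyMatrix_inv_mul_row_sub hlam ((F * Bᵀ + E)ᵀ * Fhat) i j
  have h2 : ∀ a, ((F * Bᵀ + E)ᵀ * Fhat) a = (Fhatᵀ * F) *ᵥ (B a) + (Eᵀ * Fhat) a := by
    intro a
    have h3 : (F * Bᵀ + E)ᵀ * Fhat = B * (Fhatᵀ * F)ᵀ + Eᵀ * Fhat := by
      simp only [Matrix.transpose_add, Matrix.transpose_mul, Matrix.transpose_transpose,
        Matrix.add_mul, Matrix.mul_assoc]
    rw [h3]
    change (B * (Fhatᵀ * F)ᵀ) a + (Eᵀ * Fhat) a = _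
    congr 1
    ext l
    simp [Matrix.mul_apply, Matrix.mulVec, dotProduct, mul_comm]
  rw [h2, h2] at h1
  change (1 / (T : ℝ)) • ((penaltyMatrix N lam)⁻¹ * (F * Bᵀ + E)ᵀ * Fhat) i
    - (1 / (T : ℝ)) • ((penaltyMatrix N lam)⁻¹ * (F * Bᵀ + E)ᵀ * Fhat) j = _
  rw [← smul_sub, Matrix.mul_assoc, h1, smul_smul, Matrix.mulVec_sub]
  congr 1
  abel

/-- A threshold separates the estimated within-group distances from the between-group ones. -/
theorem NoiseBounds.exists_separation (h : NoiseBounds lam c k s τ B F E)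
    (hFhat : IsFactorEstimator lam (F * Bᵀ + E) Fhat) (hlarge : 2 * k ≤ c * s) {m : ℝ}
    (hm1 : s ≤ m * τ) (hm2 : 1 ≤ m * s) (hm3 : 24 * k ^ 8 * m ≤ c ^ 2 * s)
    {K : ℕ} {g : Fin N → Fin K} (hr : 0 < r) (hB : ∀ i j, g i = g j → B i = B j) {θ : ℝ}
    (hθ : ∀ i j, g i ≠ g j → θ ≤ l2Norm (B i - B j))
    (hsep : (1 + Real.sqrt r) * (12 * k ^ 5 / c * m) < c / (4 * k ^ 4) * θ) :
    ∃ δ : ℝ, (∀ i j, g i = g j →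
        distMatrix (loadingEstimator lam (F * Bᵀ + E) Fhat) i j ≤ δ) ∧
      ∀ i j, g i ≠ g j → δ < distMatrix (loadingEstimator lam (F * Bᵀ + E) Fhat) i j := by
  have hk := h.one_le
  have hτ := h.τ_pos
  have hc := h.c_pos
  have hlam := h.lam_nonneg
  have hr' : (0 : ℝ) < r := Nat.cast_pos.mpr hr
  have hT : (0 : ℝ) < T := Nat.cast_pos.mpr h.T_pos
  set a : ℝ := 1 / (T : ℝ) * (1 / (1 + lam)) with ha
  have ha0 : 0 < a := by positivity
  -- Twice the bound for `‖V‖`, since two rows of `V` enter a difference.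
  set e := 12 * k ^ 5 / c * m * τ ^ 2 with he
  have hY : ∀ i j, l2Norm ((Eᵀ * Fhat) i - (Eᵀ * Fhat) j) ≤ e := by
    intro i j
    have h1 := h.norm_error_estimator_le hFhat hlarge hm1 hm2
    have h2 := l2Norm_sub_le ((Eᵀ * Fhat) i) ((Eᵀ * Fhat) j)
    have h3 := l2Norm_row_le (Eᵀ * Fhat) i
    have h4 := l2Norm_row_le (Eᵀ * Fhat) j
    have h5 : e = 2 * (6 * k ^ 5 / c * m * τ ^ 2) := by rw [he]; ring
    linarith
  -- Within a group only noise is left, and `‖·‖₁ ≤ √r ‖·‖₂` gives this threshold. Between groups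
  -- `‖·‖₁ ≥ ‖·‖₂` is used, so the signal must exceed `(1 + √r) e`, which is `hsep` multiplied by
  -- `τ²`.
  refine ⟨1 / (r : ℝ) * (Real.sqrt r * (a * e)), fun i j hij => ?_, fun i j hij => ?_⟩
  · rw [distMatrix, loadingEstimator_row_sub hlam, hB i j hij, sub_self, Matrix.mulVec_zero,
      zero_add]
    refine mul_le_mul_of_nonneg_left ((l1Norm_le _).trans ?_) (by positivity)
    rw [l2Norm_smul, abs_of_pos ha0]
    gcongr
    exact hY i j
  · rw [distMatrix, loadingEstimator_row_sub hlam]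
    refine mul_lt_mul_of_pos_left (lt_of_lt_of_le ?_ (l2Norm_le_l1Norm _)) (by positivity)
    rw [l2Norm_smul, abs_of_pos ha0, mul_left_comm]
    refine mul_lt_mul_of_pos_left ?_ ha0
    have h1 := h.l2Norm_cross_mulVec_ge hFhat hlarge hm1 hm2 hm3 (B i - B j)
    have h2 : l2Norm ((Fhatᵀ * F) *ᵥ (B i - B j)) ≤
        l2Norm ((Fhatᵀ * F) *ᵥ (B i - B j) + ((Eᵀ * Fhat) i - (Eᵀ * Fhat) j))
          + l2Norm ((Eᵀ * Fhat) i - (Eᵀ * Fhat) j) := by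
      refine le_trans (le_of_eq ?_) (l2Norm_sub_le _ _)
      rw [add_sub_cancel_right]
    have h3 := hY i j
    have h4 : c / (4 * k ^ 4) * θ * τ ^ 2 ≤ l2Norm ((Fhatᵀ * F) *ᵥ (B i - B j)) := by
      have h5 := mul_le_mul_of_nonneg_left (hθ i j hij) (by positivity : 0 ≤ c * τ ^ 2)
      rw [show c / (4 * k ^ 4) * θ * τ ^ 2 = c * τ ^ 2 * θ / (4 * k ^ 4) by ring,
        div_le_iff₀ (by positivity)]
      linarith
    have h6 := mul_lt_mul_of_pos_right hsep (by positivity : 0 < τ ^ 2)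
    rw [he] at h3 ⊢
    linarith

end Perturbation

/-! ### Asymptotics -/

section Asymptotics

open scoped Matrix.Norms.Frobenius

variable {Ω : Type*} [MeasurableSpace Ω] {μ : Measure Ω}

lemma measure_le_of_ae_imp {p : Ω → Prop} {U : Set Ω} (h : ∀ᵐ ω ∂μ, p ω → ω ∈ U) :
    μ {ω | p ω} ≤ μ U :=
  measure_mono_ae h

/-- Stated without complements, so that the events need not be measurable. -/
lemma tendsto_measure_one_of_le [IsProbabilityMeasure μ] {A : ℕ → Set Ω}
    (h : ∀ η : ℝ, 0 < η → ∀ᶠ n in atTop, 1 ≤ μ (A n) + ENNReal.ofReal η) :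
    Tendsto (fun n => μ (A n)) atTop (𝓝 1) := by
  refine tendsto_order.2 ⟨fun a ha => ?_, fun a ha =>
    Eventually.of_forall fun n => prob_le_one.trans_lt ha⟩
  have hat : a ≠ ⊤ := ha.ne_top
  have ha1 : a.toReal < 1 := by
    rw [← ENNReal.toReal_one]
    exact (ENNReal.toReal_lt_toReal hat ENNReal.one_ne_top).mpr ha
  filter_upwards [h ((1 - a.toReal) / 2) (by linarith)] with n hn
  have h1 : a + ENNReal.ofReal ((1 - a.toReal) / 2) < 1 := by
    rw [← ENNReal.ofReal_toReal hat, ENNReal.toReal_ofReal ENNReal.toReal_nonneg,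
      ← ENNReal.ofReal_add ENNReal.toReal_nonneg (by linarith), ENNReal.ofReal_lt_one]
    linarith
  exact lt_of_add_lt_add_right (h1.trans_le hn)

lemma eventually_le_of_tendsto_measure_one {A : ℕ → Set Ω}
    (h : Tendsto (fun n => μ (A n)) atTop (𝓝 1)) {η : ℝ} (hη : 0 < η) :
    ∀ᶠ n in atTop, 1 ≤ μ (A n) + ENNReal.ofReal η := by
  have h1 : 1 - ENNReal.ofReal η < 1 :=
    ENNReal.sub_lt_self ENNReal.one_ne_top one_ne_zero (ENNReal.ofReal_pos.mpr hη).ne'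
  filter_upwards [h.eventually (lt_mem_nhds h1)] with n hn
  exact tsub_le_iff_right.mp hn.le

lemma LoadingAssumption.exists_norm_sq_le {r : ℕ} {N : ℕ → ℕ}
    {B : (n : ℕ) → Matrix (Fin (N n)) (Fin r) ℝ} (h : LoadingAssumption N B) :
    ∃ β : ℝ, 0 ≤ β ∧ ∀ n, (∀ i, l2Norm (B n i) ^ 2 ≤ β) ∧ ‖B n‖ ^ 2 ≤ β * N n := by
  obtain ⟨⟨M, hM⟩, -⟩ := h
  have hrow : ∀ n i, l2Norm (B n i) ^ 2 ≤ r * M ^ 2 := by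
    intro n i
    rw [l2Norm_sq, dotProduct]
    calc ∑ l, B n i l * B n i l ≤ ∑ _l : Fin r, M ^ 2 := by
          refine Finset.sum_le_sum fun l _ => ?_
          rw [← sq, ← sq_abs]
          exact pow_le_pow_left₀ (abs_nonneg _) (hM n i l) 2
      _ = r * M ^ 2 := by simp
  refine ⟨r * M ^ 2, by positivity, fun n => ⟨hrow n, ?_⟩⟩
  rw [norm_sq_eq_sum]
  calc ∑ i, ∑ l, B n i l ^ 2 = ∑ i, l2Norm (B n i) ^ 2 := by
        refine Finset.sum_congr rfl fun i _ => ?_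
        rw [l2Norm_sq]
        simp [dotProduct, sq]
    _ ≤ ∑ _i : Fin (N n), (r * M ^ 2 : ℝ) := Finset.sum_le_sum fun i _ => hrow n i
    _ = _ := by simp; ring

lemma LoadingAssumption.exists_lower_bound {r : ℕ} {N : ℕ → ℕ} (hN : Tendsto N atTop atTop)
    {B : (n : ℕ) → Matrix (Fin (N n)) (Fin r) ℝ} (h : LoadingAssumption N B) :
    ∃ c : ℝ, 0 < c ∧ ∀ᶠ n in atTop, ∀ u,
      3 * c * N n * l2Norm u ^ 2 ≤ l2Norm (B n *ᵥ u) ^ 2 := by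
  obtain ⟨-, A, hlim, hA, -, c₁, c₂, hc₂, heig⟩ := h
  -- Once `BᵀB/N` is within `c₂/2` of its limit, its quadratic form is at least `c₂/2 = 3 · (c₂/6)`.
  refine ⟨c₂ / 6, by positivity, ?_⟩
  have hdist : Tendsto (fun n => ∑ i, ∑ j, (((1 / (N n : ℝ)) • ((B n)ᵀ * B n)) i j - A i j) ^ 2)
      atTop (𝓝 0) := by
    have : (0 : ℝ) = ∑ i, ∑ j, (A i j - A i j) ^ 2 := by simp
    rw [this]
    refine tendsto_finsetSum _ fun i _ => tendsto_finsetSum _ fun j _ => ?_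
    exact (((tendsto_pi_nhds.mp ((tendsto_pi_nhds.mp hlim) i)) j).sub_const _).pow 2
  filter_upwards [hdist.eventually (gt_mem_nhds (by positivity : (0 : ℝ) < (c₂ / 2) ^ 2)),
    hN.eventually (eventually_gt_atTop 0)] with n hn hNn u
  have hNn' : (0 : ℝ) < N n := Nat.cast_pos.mpr hNn
  set G := (1 / (N n : ℝ)) • ((B n)ᵀ * B n) with hG
  have h1 : ‖G - A‖ ≤ c₂ / 2 := by
    refine abs_le_of_sq_le_sq' ?_ (by positivity) |>.2
    rw [norm_sq_eq_sum]
    exact hn.le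
  have h2 := dotProduct_mulVec_ge_of_eigenvalues hA (fun i => (heig i).1) u
  have h3 : u ⬝ᵥ G *ᵥ u = l2Norm (B n *ᵥ u) ^ 2 / N n := by
    rw [hG, Matrix.smul_mulVec, dotProduct_smul, ← Matrix.mulVec_mulVec, Matrix.dotProduct_mulVec u,
      Matrix.vecMul_transpose, ← l2Norm_sq, smul_eq_mul, one_div, inv_mul_eq_div]
  have h4 : -(c₂ / 2 * l2Norm u ^ 2) ≤ u ⬝ᵥ (G - A) *ᵥ u := by
    refine (abs_le.mp ((abs_dotProduct_le _ _).trans ?_)).1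
    calc l2Norm u * l2Norm ((G - A) *ᵥ u) ≤ l2Norm u * (c₂ / 2 * l2Norm u) :=
          mul_le_mul_of_nonneg_left ((l2Norm_mulVec_le _ _).trans
            (mul_le_mul_of_nonneg_right h1 (l2Norm_nonneg u))) (l2Norm_nonneg u)
      _ = _ := by ring
  rw [Matrix.sub_mulVec, dotProduct_sub, h3] at h4
  have h5 : c₂ / 2 * l2Norm u ^ 2 ≤ l2Norm (B n *ᵥ u) ^ 2 / N n := by linarith
  rw [le_div_iff₀ hNn'] at h5
  linarith

lemma bStarSq_nonneg {N r : ℕ} (B : Matrix (Fin N) (Fin r) ℝ) : 0 ≤ bStarSq B := sq_nonneg _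

/-- Multiplying the upper bound for `λ` by `‖B*‖²` leaves `CN/T`, which is at most `cN` for large
`T`. If `B* = 0` the product vanishes and the bound for `λ` plays no role. -/
lemma mul_bStarSq_le {N T r : ℕ} {lam C c : ℝ} {B : Matrix (Fin N) (Fin r) ℝ} (hc : 0 ≤ c)
    (hT : C ≤ c * T) (hT0 : 0 < T) (hlam : lam ≤ C * ((N : ℝ) / (T * bStarSq B))) :
    lam * bStarSq B ≤ c * N := by
  have hT0' : (0 : ℝ) < T := Nat.cast_pos.mpr hT0
  rcases (bStarSq_nonneg B).eq_or_lt with h0 | h0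
  · rw [← h0, mul_zero]; positivity
  · calc lam * bStarSq B ≤ C * ((N : ℝ) / (T * bStarSq B)) * bStarSq B := by gcongr
      _ = C * N / T := by field_simp
      _ ≤ c * T * N / T := by gcongr
      _ = c * N := by field_simp

lemma sqrt_natCast_tendsto {N : ℕ → ℕ} (hN : Tendsto N atTop atTop) :
    Tendsto (fun n => Real.sqrt (N n)) atTop atTop :=
  Real.tendsto_sqrt_atTop.comp (tendsto_natCast_atTop_atTop.comp hN)

/-- A constant that controls all the error terms outside events of probability `η`. -/
lemma exists_constant (a β M η : ℝ) (r : ℕ) (hβ : 0 ≤ β) (hM : 0 ≤ M) (hη : 0 < η) :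
    ∃ k : ℝ, 1 ≤ k ∧ Real.sqrt r ≤ k ∧ β ≤ k ∧ a ^ 2 ≤ η * k ^ 2 ∧ a ^ 2 * r ≤ η * k ^ 2 ∧
      2 * a ^ 4 * (1 + M) ≤ η * k ^ 2 ∧ 2 * a ^ 4 * (1 + M) * β ≤ η * k ^ 2 := by
  set q := a ^ 2 + a ^ 2 * r + 2 * a ^ 4 * (1 + M) + 2 * a ^ 4 * (1 + M) * β with hq
  have h1 : 0 ≤ a ^ 2 := by positivity
  have h2 : 0 ≤ a ^ 2 * r := by positivity
  have h3 : 0 ≤ 2 * a ^ 4 * (1 + M) := by positivity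
  have h4 : 0 ≤ 2 * a ^ 4 * (1 + M) * β := by positivity
  have hq0 : 0 ≤ q := by positivity
  have hqη : 0 ≤ q / η := by positivity
  have hr := Real.sqrt_nonneg (r : ℝ)
  set k := 1 + Real.sqrt r + β + q / η with hk
  have hk1 : 1 ≤ k := by linarith
  -- From `q/η ≤ k ≤ k²`, as `k ≥ 1`.
  have hkq : q ≤ η * k ^ 2 := by
    have h5 : q / η ≤ k ^ 2 := by nlinarith
    rw [div_le_iff₀ hη] at h5
    linarith
  exact ⟨k, hk1, by linarith, by linarith, by linarith, by linarith, by linarith, by linarith⟩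

lemma exists_ne_label {N K : ℕ} (hK : 2 ≤ K) {g : Fin N → Fin K} (hg : Function.Surjective g) :
    ∃ i j, g i ≠ g j := by
  obtain ⟨i, hi⟩ := hg ⟨0, by omega⟩
  obtain ⟨j, hj⟩ := hg ⟨1, by omega⟩
  exact ⟨i, j, by rw [hi, hj]; simp [Fin.ext_iff]⟩

lemma le_mul_sqrt_of_sq_le {x y : ℝ} {k : ℝ} (hk : 0 ≤ k) (h : x ^ 2 ≤ k ^ 2 * y)
    {z : ℝ} (hz : 0 ≤ z) (hzy : z ^ 2 = y) : x ≤ k * z := by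
  refine abs_le_of_sq_le_sq' ?_ (by positivity) |>.2
  rwa [mul_pow, hzy]

lemma SignalBounds.noiseBounds {N T r : ℕ} {lam c k β : ℝ} {B : Matrix (Fin N) (Fin r) ℝ}
    {F : Matrix (Fin T) (Fin r) ℝ} {E : Matrix (Fin T) (Fin N) ℝ}
    (h : SignalBounds lam c B F E) (hk : 1 ≤ k) (hkr : Real.sqrt r ≤ k) (hkβ : β ≤ k)
    (hB : ‖B‖ ^ 2 ≤ β * N) (hE : ‖E‖ ^ 2 ≤ k ^ 2 * (N * T))
    (hEF : ‖Eᵀ * F‖ ^ 2 ≤ k ^ 2 * (N * T)) (hEE : ‖Eᵀ * E‖ ^ 2 ≤ k ^ 2 * (N * T ^ 2))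
    (hEB : ‖Eᵀ * E * ((penaltyMatrix N lam)⁻¹ * B)‖ ^ 2 ≤ k ^ 2 * (N * T ^ 2)) :
    NoiseBounds lam c k (Real.sqrt N) (Real.sqrt T) B F E := by
  have hN0 : (0 : ℝ) < N := Nat.cast_pos.mpr h.N_pos
  have hT0 : (0 : ℝ) < T := Nat.cast_pos.mpr h.T_pos
  have hs2 := Real.sq_sqrt hN0.le
  have hτ2 := Real.sq_sqrt hT0.le
  have hst : (Real.sqrt N * Real.sqrt T) ^ 2 = N * T := by rw [mul_pow, hs2, hτ2]
  have hstt : (Real.sqrt N * Real.sqrt T ^ 2) ^ 2 = N * T ^ 2 := by rw [mul_pow, hs2, hτ2]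
  have hk0 : 0 ≤ k := by linarith
  have hkk : β * (N : ℝ) ≤ k ^ 2 * N := by gcongr; nlinarith
  exact
    { h with
      one_le := hk
      s_pos := Real.sqrt_pos.mpr hN0
      s_sq := hs2
      τ_pos := Real.sqrt_pos.mpr hT0
      τ_sq := hτ2
      sqrt_le := hkr
      norm_loading := le_mul_sqrt_of_sq_le hk0 (hB.trans hkk) (Real.sqrt_nonneg _) hs2
      norm_error := le_mul_sqrt_of_sq_le hk0 hE (by positivity) hst
      norm_error_factor := le_mul_sqrt_of_sq_le hk0 hEF (by positivity) hst
      norm_error_gram := le_mul_sqrt_of_sq_le hk0 hEE (by positivity) hstt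
      norm_error_gram_loading := le_mul_sqrt_of_sq_le hk0 hEB (by positivity) hstt }

/-- Under the noise bounds, a signal of larger order than `max {√(N/T), N^{-1/2}}` is recovered
by the clustering algorithm. -/
theorem NoiseBounds.isAHCOutput_iff {N T r : ℕ} {lam c k : ℝ} {B : Matrix (Fin N) (Fin r) ℝ}
    {F Fhat : Matrix (Fin T) (Fin r) ℝ} {E : Matrix (Fin T) (Fin N) ℝ}
    (hnb : NoiseBounds lam c k (Real.sqrt N) (Real.sqrt T) B F E)
    (hFhat : IsFactorEstimator lam (F * Bᵀ + E) Fhat) (hNT : N ≤ T)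
    (hlarge : 2 * k ≤ c * Real.sqrt N) (hlarge8 : 24 * k ^ 8 ≤ c ^ 2 * Real.sqrt N)
    {K : ℕ} (hK : 2 ≤ K) {g : Fin N → Fin K} (hg : Function.Surjective g)
    (hB : ∀ i j, g i = g j → B i = B j) {d h : ℝ} (hh : 0 < h)
    (hd : ∀ i j, g i ≠ g j → d ≤ h * l2Norm (B i - B j))
    (hmd : max (Real.sqrt ((N : ℝ) / (T : ℝ))) (1 / Real.sqrt (N : ℝ)) ≤
      c / (4 * k ^ 4) / h / (2 * ((1 + Real.sqrt r) * (12 * k ^ 5 / c))) * d)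
    (P : Finset (Finset (Fin N))) :
    IsAHCOutput (distMatrix (loadingEstimator lam (F * Bᵀ + E) Fhat)) K P
      ↔ P = truePartition g := by
  have hk := hnb.one_le
  have hc := hnb.c_pos
  have hN0 : (0 : ℝ) < N := Nat.cast_pos.mpr hnb.N_pos
  have hT0 : (0 : ℝ) < T := Nat.cast_pos.mpr hnb.T_pos
  have hNT' : (N : ℝ) ≤ T := by exact_mod_cast hNT
  have hs0 := hnb.s_pos
  have hτ0 := hnb.τ_pos
  set L := (1 + Real.sqrt r) * (12 * k ^ 5 / c) with hL
  set κ := c / (4 * k ^ 4) / h with hκ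
  have hL0 : 0 < L := by positivity
  have hκ0 : 0 < κ := by positivity
  set m := max (Real.sqrt ((N : ℝ) / (T : ℝ))) (1 / Real.sqrt (N : ℝ)) with hm
  have hm0 : 0 < m := lt_max_of_lt_right (by positivity)
  have hd0 : 0 < d := pos_of_mul_pos_right (hm0.trans_le hmd) (by positivity)
  have hm1 : Real.sqrt N ≤ m * Real.sqrt T := by
    rw [← div_le_iff₀ hτ0, ← Real.sqrt_div hN0.le]
    exact le_max_left _ _
  have hm2 : 1 ≤ m * Real.sqrt N := by
    rw [← div_le_iff₀ hs0]
    exact le_max_right _ _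
  have hm_le : m ≤ 1 := by
    refine max_le ?_ ?_
    · rw [Real.sqrt_le_one]
      exact div_le_one_of_le₀ hNT' hT0.le
    · rw [div_le_one hs0, Real.one_le_sqrt]
      exact_mod_cast hnb.N_pos
  have hm3 : 24 * k ^ 8 * m ≤ c ^ 2 * Real.sqrt N :=
    (mul_le_of_le_one_right (by positivity) hm_le).trans hlarge8
  have hθ : ∀ i j, g i ≠ g j → d / h ≤ l2Norm (B i - B j) := fun i j hij => by
    rw [div_le_iff₀ hh, mul_comm]
    exact hd i j hij
  -- With no factors all loadings coincide, which contradicts a positive signal between two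
  -- different groups.
  have hr : 0 < r := by
    rcases Nat.eq_zero_or_pos r with rfl | hr
    · obtain ⟨i, j, hij⟩ := exists_ne_label hK hg
      have h6 : l2Norm (B i - B j) ^ 2 = 0 := by
        rw [l2Norm_sq]
        simp [dotProduct]
      rw [pow_eq_zero_iff two_ne_zero] at h6
      have h7 : 0 < d / h := by positivity
      linarith [hθ i j hij]
    · exact hr
  -- The constant in `hmd` is chosen so that the noise is at most half of the signal; `d > 0` makes
  -- the inequality strict.
  have hsep : (1 + Real.sqrt r) * (12 * k ^ 5 / c * m) < c / (4 * k ^ 4) * (d / h) := by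
    have h5 : L * m ≤ κ * d / 2 := by
      calc L * m ≤ L * (κ / (2 * L) * d) := mul_le_mul_of_nonneg_left hmd hL0.le
        _ = κ * d / 2 := by field_simp
    have h6 : 0 < κ * d := by positivity
    calc _ = L * m := by rw [hL]; ring
      _ < κ * d := by linarith
      _ = _ := by rw [hκ]; ring
  obtain ⟨δ, hsame, hdiff⟩ := hnb.exists_separation hFhat hlarge hm1 hm2 hm3 hr hB hθ hsep
  have : Nonempty (Fin K) := ⟨⟨0, by omega⟩⟩
  exact isAHCOutput_iff_of_separated hg hsame hdiff P

end Asymptotics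

/-! ### Proof of the consistency theorem -/

section Main

open scoped Matrix.Norms.Frobenius

/-- Consistency of complete-linkage clustering of the penalized PCA loadings. -/
theorem tendsto_measure_isAHCOutput {Ω : Type*} [MeasurableSpace Ω] (μ : Measure Ω)
    [IsProbabilityMeasure μ] (r K₀ : ℕ) (hK₀ : 2 ≤ K₀) (N T : ℕ → ℕ)
    (hN : Tendsto N atTop atTop) (hT : Tendsto T atTop atTop)
    (g : (n : ℕ) → Fin (N n) → Fin K₀) (hg : ∀ n, Function.Surjective (g n))
    (B : (n : ℕ) → Matrix (Fin (N n)) (Fin r) ℝ) (hB : ∀ n i j, g n i = g n j → B n i = B n j)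
    (F : (n : ℕ) → Ω → Matrix (Fin (T n)) (Fin r) ℝ)
    (S : (n : ℕ) → Ω → Matrix (Fin (T n)) (Fin (N n)) ℝ)
    (P₁ : (n : ℕ) → Matrix (Fin (T n)) (Fin (T n)) ℝ)
    (P₂ : (n : ℕ) → Matrix (Fin (N n)) (Fin (N n)) ℝ)
    (hF : FactorAssumption μ T F) (hload : LoadingAssumption N B)
    (herr : ErrorAssumption μ N T F S P₁ P₂) (lam : ℕ → ℝ)
    (hlam : ∃ c C : ℝ, 0 < c ∧ 0 < C ∧ ∀ᶠ n in atTop,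
      c * ((N n : ℝ) / ((T n : ℝ) * bStarSq (B n))) ≤ lam n ∧
      lam n ≤ C * ((N n : ℝ) / ((T n : ℝ) * bStarSq (B n))))
    (Fhat : (n : ℕ) → Ω → Matrix (Fin (T n)) (Fin r) ℝ)
    (hFhat : ∀ n ω, IsFactorEstimator (lam n) (F n ω * (B n)ᵀ + P₁ n * S n ω * P₂ n) (Fhat n ω))
    (hd : ∀ ε : ℝ, 0 < ε → Tendsto (fun n => μ {ω |
      max (Real.sqrt ((N n : ℝ) / (T n : ℝ))) (1 / Real.sqrt (N n : ℝ)) ≤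
        ε * minSignal (g n) (B n) (rotation (lam n) (B n) (F n ω)
          (F n ω * (B n)ᵀ + P₁ n * S n ω * P₂ n) (Fhat n ω))}) atTop (𝓝 1)) :
    Tendsto (fun n => μ {ω | ∀ P : Finset (Finset (Fin (N n))),
      IsAHCOutput (distMatrix (loadingEstimator (lam n)
        (F n ω * (B n)ᵀ + P₁ n * S n ω * P₂ n) (Fhat n ω))) K₀ P ↔
        P = truePartition (g n)}) atTop (𝓝 1) := by
  obtain ⟨β, hβ, hBβ⟩ := hload.exists_norm_sq_le
  obtain ⟨c, hc, hload_lower⟩ := hload.exists_lower_bound hN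
  obtain ⟨cl, C, hcl, hC, hlam⟩ := hlam
  obtain ⟨-, MF, -, hF⟩ := hF
  obtain ⟨hSm, hSi, hSF, ⟨M, hSM⟩, c₁, c₂, hc₂, hP⟩ := herr
  set a := max c₁ 0 with ha
  have ha0 : 0 ≤ a := le_max_right _ _
  have hP₁ : ∀ n x, l2Norm (P₁ n *ᵥ x) ^ 2 ≤ a * l2Norm x ^ 2 := fun n =>
    l2Norm_mulVec_sq_le_of_eigDesc fun j hj => ((hP n).1 j hj).2.trans (le_max_left _ _)
  have hP₂ : ∀ n x, l2Norm (P₂ n *ᵥ x) ^ 2 ≤ a * l2Norm x ^ 2 := fun n =>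
    l2Norm_mulVec_sq_le_of_eigDesc fun j hj => ((hP n).2 j hj).2.trans (le_max_left _ _)
  have hnoise : ∀ n, IsNoise μ (S n) |M| := fun n =>
    { measurable := hSm n
      indep := hSi n
      memLp := fun t j => (hSM n t j).1
      mean := fun t j => (hSM n t j).2.1
      variance := fun t j => (hSM n t j).2.2.1
      fourth := fun t j => (hSM n t j).2.2.2.trans (le_abs_self M) }
  have hF2 : ∀ n t l, MemLp (fun ω => F n ω t l) 2 μ := fun n t l =>
    ((hF n).1 t l).1.mono_exponent (by norm_num)
  set E : (n : ℕ) → Ω → Matrix (Fin (T n)) (Fin (N n)) ℝ := fun n ω => P₁ n * S n ω * P₂ n with hE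
  -- The bound for `‖H‖`, enlarged by `1` to be positive in all cases.
  set h : ℝ := β * r * (Real.sqrt r / c) + 1 with hh
  have hh0 : 0 < h := by positivity
  have hNpos : ∀ᶠ n in atTop, 0 < N n := hN.eventually (eventually_gt_atTop 0)
  have hTpos : ∀ᶠ n in atTop, 0 < T n := hT.eventually (eventually_gt_atTop 0)
  have hs_top := sqrt_natCast_tendsto hN
  have hτ_top := sqrt_natCast_tendsto hT
  have horth : ∀ᶠ n in atTop, ∀ᵐ ω ∂μ, (F n ω)ᵀ * F n ω = (T n : ℝ) • 1 := by
    filter_upwards [hTpos] with n hTn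
    filter_upwards [(hF n).2.1] with ω hω
    have : (T n : ℝ) ≠ 0 := by positivity
    rw [← hω, smul_smul, mul_one_div_cancel this, one_smul]
  -- Only `T → ∞` and the bound for `EᵀF` enter here, not `N ≤ T`; hence `H` and `d_n` can be
  -- bounded before `N ≤ T` is known.
  have hsignal : ∀ k : ℝ, 1 ≤ k → β ≤ k → ∀ᶠ n in atTop, ∀ ω,
      (F n ω)ᵀ * F n ω = (T n : ℝ) • 1 → ‖(E n ω)ᵀ * F n ω‖ ^ 2 ≤ k ^ 2 * (N n * T n) →
      SignalBounds (lam n) c (B n) (F n ω) (E n ω) := by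
    intro k hk hβk
    filter_upwards [hNpos, hTpos, hload_lower, hlam,
      (tendsto_natCast_atTop_atTop.comp hT).eventually (eventually_ge_atTop (C / c)),
      hτ_top.eventually (eventually_ge_atTop (2 * k ^ 2 / c))] with n hNn hTn hl hlamn hTC hτk ω
      hFω hEF
    have hTC' : C ≤ c * T n := by
      simp only [Function.comp] at hTC
      rw [div_le_iff₀ hc] at hTC
      linarith
    refine ⟨?_, hNn, hTn, hc, hFω, hl, mul_bStarSq_le hc.le hTC' hTn hlamn.2, ?_⟩
    · refine le_trans ?_ hlamn.1
      have := bStarSq_nonneg (B n)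
      positivity
    · have hs2 := Real.sq_sqrt (Nat.cast_nonneg (α := ℝ) (N n))
      have hτ2 := Real.sq_sqrt (Nat.cast_nonneg (α := ℝ) (T n))
      have h1 : ‖B n‖ ≤ k * Real.sqrt (N n) := by
        refine le_mul_sqrt_of_sq_le (by positivity) ((hBβ n).2.trans ?_) (Real.sqrt_nonneg _) hs2
        gcongr
        nlinarith
      have h2 : ‖(E n ω)ᵀ * F n ω‖ ≤ k * (Real.sqrt (N n) * Real.sqrt (T n)) :=
        le_mul_sqrt_of_sq_le (by positivity) hEF (by positivity) (by rw [mul_pow, hs2, hτ2])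
      have h3 : 2 * k ^ 2 ≤ c * Real.sqrt (T n) := by
        rw [div_le_iff₀ hc] at hτk
        linarith
      calc 2 * (‖B n‖ * ‖(E n ω)ᵀ * F n ω‖)
          ≤ 2 * ((k * Real.sqrt (N n)) * (k * (Real.sqrt (N n) * Real.sqrt (T n)))) := by gcongr
        _ = 2 * k ^ 2 * (Real.sqrt (N n) ^ 2 * Real.sqrt (T n)) := by ring
        _ ≤ c * Real.sqrt (T n) * (Real.sqrt (N n) ^ 2 * Real.sqrt (T n)) := by gcongr
        _ = c * Real.sqrt (N n) ^ 2 * Real.sqrt (T n) ^ 2 := by ring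
        _ = c * N n * T n := by rw [hs2, hτ2]
  have hrot : ∀ n ω, SignalBounds (lam n) c (B n) (F n ω) (E n ω) → ∀ i j, g n i ≠ g n j →
      minSignal (g n) (B n) (rotation (lam n) (B n) (F n ω) (F n ω * (B n)ᵀ + E n ω) (Fhat n ω))
        ≤ h * l2Norm (B n i - B n j) := by
    intro n ω hsb i j hij
    refine (minSignal_le _ _ hij).trans (mul_le_mul_of_nonneg_right ?_ (l2Norm_nonneg _))
    exact (hsb.norm_rotation_le (hFhat n ω).1 (hBβ n).2).trans (by linarith)
  have hEFprob : ∀ k η : ℝ, 0 < k → a ^ 2 * r ≤ η * k ^ 2 → ∀ᶠ n in atTop,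
      μ {ω | k ^ 2 * (N n * T n) < ‖(E n ω)ᵀ * F n ω‖ ^ 2} ≤ ENNReal.ofReal η := by
    intro k η hk hkη
    filter_upwards [hNpos, hTpos] with n hNn hTn
    refine measure_norm_error_transpose_mul_gt_le (hnoise n) ha0 (hP₁ n) (hP₂ n) (hF2 n)
      (fun t l => ((hF n).1 t l).2.2.1) (hSF n) (by positivity) ?_
    calc a ^ 2 * (N n * (T n * r)) = a ^ 2 * r * (N n * T n) := by ring
      _ ≤ η * k ^ 2 * (N n * T n) := by gcongr
      _ = _ := by ring
  -- If `N > T`, then `√(N/T) ≥ 1`, while on the good event `ε d_n < 1` by the choice of `ε`. So the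
  -- event of the signal assumption would lie in a bad event of probability at most `1/4`, although
  -- its own probability is at least `3/4`.
  have hNT : ∀ᶠ n in atTop, N n ≤ T n := by
    obtain ⟨k, hk1, -, hkβ, -, hkF, -, -⟩ :=
      exists_constant a β |M| (1 / 4) r hβ (abs_nonneg M) (by norm_num)
    set ε : ℝ := 1 / (h * (2 * Real.sqrt β) + 1) with hε
    have hε0 : 0 < ε := by positivity
    filter_upwards [hNpos, hTpos, horth, hsignal k hk1 hkβ, hEFprob k _ (by linarith) hkF,
      eventually_le_of_tendsto_measure_one (hd ε hε0) (by norm_num : (0 : ℝ) < 1 / 4)]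
      with n hNn hTn hor hsig hEF hdn
    by_contra hlt
    rw [not_le] at hlt
    have hsub : ∀ᵐ ω ∂μ,
        max (Real.sqrt ((N n : ℝ) / (T n : ℝ))) (1 / Real.sqrt (N n : ℝ)) ≤
        ε * minSignal (g n) (B n) (rotation (lam n) (B n) (F n ω)
          (F n ω * (B n)ᵀ + P₁ n * S n ω * P₂ n) (Fhat n ω)) →
        ω ∈ {ω | k ^ 2 * (N n * T n) < ‖(E n ω)ᵀ * F n ω‖ ^ 2} := by
      filter_upwards [hor] with ω hω hmem
      by_contra hnot
      have hsb := hsig ω hω (not_lt.mp hnot)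
      obtain ⟨i, j, hij⟩ := exists_ne_label hK₀ (hg n)
      have h1 := hrot n ω hsb i j hij
      have hrow : ∀ i, l2Norm (B n i) ≤ Real.sqrt β := fun i =>
        Real.le_sqrt_of_sq_le ((hBβ n).1 i)
      have h2 : l2Norm (B n i - B n j) ≤ 2 * Real.sqrt β := by
        have := l2Norm_sub_le (B n i) (B n j)
        linarith [hrow i, hrow j]
      have h3 : Real.sqrt ((N n : ℝ) / (T n : ℝ)) ≤ ε * (h * (2 * Real.sqrt β)) := by
        refine (le_max_left _ _).trans (le_trans hmem ?_)
        refine mul_le_mul_of_nonneg_left (h1.trans ?_) hε0.le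
        gcongr
      have h4 : ε * (h * (2 * Real.sqrt β)) < 1 := by
        rw [hε, one_div, inv_mul_eq_div, div_lt_one (by positivity)]
        linarith
      have h5 : 1 ≤ Real.sqrt ((N n : ℝ) / (T n : ℝ)) := by
        rw [Real.one_le_sqrt, one_le_div (by positivity)]
        exact_mod_cast hlt.le
      linarith
    have h1 := (measure_le_of_ae_imp hsub).trans hEF
    have h2 : (1 : ENNReal) ≤ ENNReal.ofReal (1 / 4) + ENNReal.ofReal (1 / 4) :=
      hdn.trans (add_le_add_left h1 _)
    rw [← ENNReal.ofReal_add (by norm_num) (by norm_num), ENNReal.one_le_ofReal] at h2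
    norm_num at h2
  refine tendsto_measure_one_of_le fun η₀ hη₀ => ?_
  -- Five exceptional events: failure of the signal assumption and of the bounds for `EᵀF`, `EᵀE`,
  -- `EᵀE D⁻¹B` and `E`.
  set η := η₀ / 5 with hη
  have hη0 : 0 < η := by positivity
  obtain ⟨k, hk1, hkr, hkβ, hkE, hkF, hkG, hkGB⟩ :=
    exists_constant a β |M| η r hβ (abs_nonneg M) hη0
  set L := (1 + Real.sqrt r) * (12 * k ^ 5 / c) with hL
  set κ := c / (4 * k ^ 4) / h with hκ
  have hL0 : 0 < L := by positivity
  have hκ0 : 0 < κ := by positivity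
  set ε := κ / (2 * L) with hε
  have hε0 : 0 < ε := by positivity
  filter_upwards [hNpos, hTpos, hNT, horth, hsignal k hk1 hkβ, hEFprob k η (by linarith) hkF,
    eventually_le_of_tendsto_measure_one (hd ε hε0) hη0,
    hs_top.eventually (eventually_ge_atTop (2 * k / c)),
    hs_top.eventually (eventually_ge_atTop (24 * k ^ 8 / c ^ 2)),
    hlam] with n hNn hTn hNTn hor hsig hEF hdn hsk hsk8 hlamn
  have hN0 : (0 : ℝ) < N n := Nat.cast_pos.mpr hNn
  have hT0 : (0 : ℝ) < T n := Nat.cast_pos.mpr hTn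
  have hNT' : (N n : ℝ) ≤ T n := by exact_mod_cast hNTn
  have hlam0 : 0 ≤ lam n := by
    refine le_trans ?_ hlamn.1
    have := bStarSq_nonneg (B n)
    positivity
  have hgram : ∀ {q : ℕ} (W : Matrix (Fin (N n)) (Fin q) ℝ) (b : ℝ), 0 ≤ b →
      ‖W‖ ^ 2 ≤ b * N n → 2 * a ^ 4 * (1 + |M|) * b ≤ η * k ^ 2 →
      μ {ω | k ^ 2 * (N n * T n ^ 2) < ‖(E n ω)ᵀ * E n ω * W‖ ^ 2} ≤ ENNReal.ofReal η := by
    intro q W b hb hW hbk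
    refine measure_norm_error_gram_mul_gt_le (hnoise n) ha0 (abs_nonneg M) (hP₁ n) (hP₂ n) W
      (by positivity) ?_
    have h1 : (N n : ℝ) * T n + T n ^ 2 * |M| ≤ T n ^ 2 * (1 + |M|) := by
      nlinarith [mul_le_mul_of_nonneg_right hNT' hT0.le]
    calc 2 * a ^ 4 * (N n * T n + T n ^ 2 * |M|) * ‖W‖ ^ 2
        ≤ 2 * a ^ 4 * (T n ^ 2 * (1 + |M|)) * (b * N n) := by gcongr
      _ = 2 * a ^ 4 * (1 + |M|) * b * (N n * T n ^ 2) := by ring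
      _ ≤ η * k ^ 2 * (N n * T n ^ 2) := by gcongr
      _ = _ := by ring
  have hone : ‖(1 : Matrix (Fin (N n)) (Fin (N n)) ℝ)‖ ^ 2 ≤ 1 * N n := by
    rw [norm_sq_eq_trace]
    simp
  have hG1 := hgram 1 1 zero_le_one hone (by rwa [mul_one])
  have hG2 := hgram ((penaltyMatrix (N n) (lam n))⁻¹ * B n) β hβ
    ((pow_le_pow_left₀ (norm_nonneg _) (norm_penaltyMatrix_inv_mul_le hlam0 _) 2).trans (hBβ n).2)
    hkGB
  have hG3 : μ {ω | k ^ 2 * (N n * T n) < ‖E n ω‖ ^ 2} ≤ ENNReal.ofReal η := by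
    refine measure_norm_error_gt_le (hnoise n) ha0 (hP₁ n) (hP₂ n) (by positivity) ?_
    calc a ^ 2 * (T n * N n) ≤ η * k ^ 2 * (T n * N n) := by gcongr
      _ = _ := by ring
  -- The remaining argument is deterministic: where the signal assumption holds, either recovery
  -- succeeds or one of the four noise bounds fails. The exceptional null set is that of `FᵀF = T
  -- I`.
  have hsub : ∀ᵐ ω ∂μ,
      max (Real.sqrt ((N n : ℝ) / (T n : ℝ))) (1 / Real.sqrt (N n : ℝ)) ≤
      ε * minSignal (g n) (B n) (rotation (lam n) (B n) (F n ω)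
        (F n ω * (B n)ᵀ + P₁ n * S n ω * P₂ n) (Fhat n ω)) →
      ω ∈ {ω | ∀ P : Finset (Finset (Fin (N n))),
        IsAHCOutput (distMatrix (loadingEstimator (lam n)
          (F n ω * (B n)ᵀ + P₁ n * S n ω * P₂ n) (Fhat n ω))) K₀ P ↔ P = truePartition (g n)} ∪
        ({ω | k ^ 2 * (N n * T n) < ‖(E n ω)ᵀ * F n ω‖ ^ 2} ∪
        ({ω | k ^ 2 * (N n * T n ^ 2) < ‖(E n ω)ᵀ * E n ω * 1‖ ^ 2} ∪
        ({ω | k ^ 2 * (N n * T n ^ 2)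
            < ‖(E n ω)ᵀ * E n ω * ((penaltyMatrix (N n) (lam n))⁻¹ * B n)‖ ^ 2} ∪
        {ω | k ^ 2 * (N n * T n) < ‖E n ω‖ ^ 2}))) := by
    filter_upwards [hor] with ω hω hmem
    by_contra hnot
    simp only [Set.mem_union, Set.mem_ofPred_eq, not_or, not_lt] at hnot
    obtain ⟨hnot, h1, h2, h3, h4⟩ := hnot
    refine hnot fun P => ?_
    rw [Matrix.mul_one] at h2
    have hsb := hsig ω hω h1
    have hnb := hsb.noiseBounds hk1 hkr hkβ (hBβ n).2 h4 h1 h2 h3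
    have hlarge : 2 * k ≤ c * Real.sqrt (N n) := by
      rw [div_le_iff₀ hc] at hsk
      linarith
    have hlarge8 : 24 * k ^ 8 ≤ c ^ 2 * Real.sqrt (N n) := by
      rw [div_le_iff₀ (by positivity)] at hsk8
      linarith
    exact hnb.isAHCOutput_iff (hFhat n ω) hNTn hlarge hlarge8 hK₀ (hg n) (hB n) hh0
      (hrot n ω hsb) hmem P
  have hmeas := measure_le_of_ae_imp hsub
  refine hdn.trans ?_
  have hη5 : ENNReal.ofReal η₀ = ENNReal.ofReal η + (ENNReal.ofReal η + (ENNReal.ofReal η +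
      ENNReal.ofReal η)) + ENNReal.ofReal η := by
    rw [← ENNReal.ofReal_add (by positivity) (by positivity),
      ← ENNReal.ofReal_add (by positivity) (by positivity),
      ← ENNReal.ofReal_add (by positivity) (by positivity),
      ← ENNReal.ofReal_add (by positivity) (by positivity)]
    congr 1
    rw [hη]
    ring
  rw [hη5, ← add_assoc]
  gcongr
  refine hmeas.trans ((measure_union_le _ _).trans ?_)
  gcongr
  refine (measure_union_le _ _).trans (add_le_add hEF ?_)
  refine (measure_union_le _ _).trans (add_le_add hG1 ?_)
  exact (measure_union_le _ _).trans (add_le_add hG2 hG3)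

end Main

end PPCA

theorem theorem4 {Ω : Type*} [MeasurableSpace Ω] (μ : Measure Ω) [IsProbabilityMeasure μ]
    (r K₀ : ℕ) (hK₀ : 2 ≤ K₀) (N T : ℕ → ℕ)
    (hN : Tendsto N atTop atTop) (hT : Tendsto T atTop atTop)
    -- the groups and the group-specific loadings
    (g : (n : ℕ) → Fin (N n) → Fin K₀) (hg : ∀ n, Function.Surjective (g n))
    (bG : (n : ℕ) → Fin K₀ → Fin r → ℝ)
    (B : (n : ℕ) → Matrix (Fin (N n)) (Fin r) ℝ) (hB : ∀ n i, B n i = bG n (g n i))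
    -- the factor model `X = F Bᵀ + P₁ S P₂`
    (F : (n : ℕ) → Ω → Matrix (Fin (T n)) (Fin r) ℝ)
    (S : (n : ℕ) → Ω → Matrix (Fin (T n)) (Fin (N n)) ℝ)
    (P₁ : (n : ℕ) → Matrix (Fin (T n)) (Fin (T n)) ℝ)
    (P₂ : (n : ℕ) → Matrix (Fin (N n)) (Fin (N n)) ℝ)
    (X : (n : ℕ) → Ω → Matrix (Fin (T n)) (Fin (N n)) ℝ)
    (hX : ∀ n ω, X n ω = F n ω * (B n)ᵀ + P₁ n * S n ω * P₂ n)
    (hF : PPCA.FactorAssumption μ T F)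
    (hload : PPCA.LoadingAssumption N B)
    (herr : PPCA.ErrorAssumption μ N T F S P₁ P₂)
    -- the tuning parameter is of the exact order `N / (T ‖B*‖_F²)`
    (lam : ℕ → ℝ)
    (hlam : ∃ c C : ℝ, 0 < c ∧ 0 < C ∧ ∀ᶠ n in atTop,
      c * ((N n : ℝ) / ((T n : ℝ) * PPCA.bStarSq (B n))) ≤ lam n ∧
      lam n ≤ C * ((N n : ℝ) / ((T n : ℝ) * PPCA.bStarSq (B n))))
    -- the PPCA factor scores
    (Fhat : (n : ℕ) → Ω → Matrix (Fin (T n)) (Fin r) ℝ)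
    (hFhat_meas : ∀ n t l, Measurable fun ω => Fhat n ω t l)
    (hFhat : ∀ n ω, PPCA.IsFactorEstimator (lam n) (X n ω) (Fhat n ω))
    -- `max {√(N/T), N^{-1/2}} = o(d_n)` in probability
    (hd : ∀ ε : ℝ, 0 < ε → Tendsto (fun n => μ {ω |
      max (Real.sqrt ((N n : ℝ) / (T n : ℝ))) (1 / Real.sqrt (N n : ℝ)) ≤
        ε * PPCA.minSignal (g n) (B n)
          (PPCA.rotation (lam n) (B n) (F n ω) (X n ω) (Fhat n ω))}) atTop (𝓝 1)) :
    -- with probability tending to `1`, the algorithm returns the true partition, however ties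
    -- are broken
    Tendsto (fun n => μ {ω | ∀ P : Finset (Finset (Fin (N n))),
      PPCA.IsAHCOutput (PPCA.distMatrix (PPCA.loadingEstimator (lam n) (X n ω) (Fhat n ω))) K₀ P ↔
        P = PPCA.truePartition (g n)}) atTop (𝓝 1) := by
  obtain rfl : X = fun n ω => F n ω * (B n)ᵀ + P₁ n * S n ω * P₂ n :=
    funext fun n => funext fun ω => hX n ω
  exact PPCA.tendsto_measure_isAHCOutput μ r K₀ hK₀ N T hN hT g hg B
    (fun n i j hij => by rw [hB, hB, hij]) F S P₁ P₂ hF hload herr lam hlam Fhat hFhat hd
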